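/- Consider univariate real time series $X=(X_t)_{t\in\mathbb Z}$, $Y=(Y_t)_{t\in\mathbb Z}$, $Z=(Z_t)_{t\in\mathbb Z}$ and write $W_t=(X_t,Y_t,Z_t)$. Let $\Xi$ be the set of all laws of $(W_t)_{t\in\mathbb Z}$ such that - $W$ is strictly stationary and first-order Markov: $W_{t+1}$ is conditionally independent of $(W_s)_{s\le t}$ given $W_t$, for all $t$; - $X$ and $Y$ are structurally generated with iid noise: on some probability space carrying a version of $W$ and real noise variables, almost surely for every $t\in\mathbb Z$ $$X_t=h_X(X_{t-1},Y_{t-1},Z_{t-1},\varepsilon^X_t),\qquad Y_t=h_Y(X_{t-1},Y_{t-1},Z_{t-1},\varepsilon^Y_t),$$ with measurable $h_X,h_Y$ not depending on $t$ and noise vectors $(\varepsilon^X_t,\varepsilon^Y_t)$, $t\in\mathbb Z$, that are independent and identically distributed over $t$; - $W$ is continuous with respect to Lebesgue measure: for all $t\in\mathbb Z$ and $m\in\mathbb N$ the law of $(W_{t+1},\dots,W_{t+m})$ on $\mathbb R^{3m}$ is absolutely continuous; - $X$ and $Y$ are supported on a neighbourhood of infinity: for every $t$ the supports of the laws of $X_t$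 and $Y_t$ contain a half-line $(c,\infty)$. Let $F$ be a distribution function on $\mathbb R$ with $F(x)<1$ for all $x\in\mathbb R$, and let $$\Gamma_{X\to Y\mid Z}:=\lim_{v\to\infty}\mathbb E\bigl[F(Y_{t+1})\mid X_t>v,\ (Y_s,Z_s)_{s\le t}\bigr],$$ a random variable, where the conditional expectation is formed from a regular conditional law given $\sigma(Y_s,Z_s:s\le t)$ by conditioning it on the event $\{X_t>v\}$; the coefficient is well defined where all these events have positive conditional probability and the limit exists. Let $\mathcal P_0\subseteq\Xi$ be the set of laws satisfying the null hypothesis $H_0:\Gamma_{X\to Y\mid Z}<1$, that is, for which (for every $t$) $\Gamma_{X\to Y\mid Z}$ is almost surely well defined and smaller than $1$, and let $\mathcal Q_0:=\Xi\setminus\mathcal P_0$. Then $H_0$ is untestable: for every $n\in\mathbb N$ and every test, i.e. every measurable function $\psi_n:(\mathbb R^3)^n\to\{0,1\}$ (the value $1$ meaning rejection), applied to the sample $W_1,\dots,W_n$, $$\sup_{Q\in\mathcal Q_0}P_Q\bigl(\psi_n(W_1,\dots,W_n)=1\bigr)\ \le\ \sup_{P\in\mathcal P_0}P_P\bigl(\psi_n(W_1,\dots,W_n)=1\bigr).$$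 -/

import Mathlib

open MeasureTheory ProbabilityTheory Filter
open scoped Topology ENNReal

namespace TailTesting

/-- Paths `(x_t, y_t, z_t)_{t ∈ ℤ}` of a trivariate real time series, with the product σ-algebra. -/
abbrev Path : Type := ℤ → ℝ × ℝ × ℝ

/-- The law of a trivariate time series `(X, Y, Z)`: a probability measure on path space. The series
itself is then the coordinate process. -/
abbrev Law : Type := ProbabilityMeasure Path

/-- The `X`-coordinate process. -/
def X (t : ℤ) (w : Path) : ℝ := (w t).1

/-- The `Y`-coordinate process. -/
def Y (t : ℤ) (w : Path) : ℝ := (w t).2.1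

/-- The `Z`-coordinate process. -/
def Z (t : ℤ) (w : Path) : ℝ := (w t).2.2

/-- Strict stationarity of the joint series: its law is invariant under all time shifts. -/
def IsStationary (P : Law) : Prop :=
  ∀ s : ℤ, (P : Measure Path).map (fun w t => w (t + s)) = (P : Measure Path)

/-- All finite-dimensional distributions have a density with respect to Lebesgue measure: for every
time `t` and length `m`, the law of `(W_{t+1}, …, W_{t+m})` on `(ℝ³)^m` is absolutely continuous. -/
def IsContinuousLaw (P : Law) : Prop :=
  ∀ (t : ℤ) (m : ℕ),
    (P : Measure Path).map (fun w (i : Fin m) => w (t + 1 + (i : ℕ))) ≪ volume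

/-- `X_t` and `Y_t` are supported on a neighbourhood of `+∞`. -/
def IsSupportedNearInfinity (P : Law) : Prop :=
  ∀ t : ℤ, ∃ c : ℝ, Set.Ioi c ⊆ ((P : Measure Path).map (X t)).support ∧
    Set.Ioi c ⊆ ((P : Measure Path).map (Y t)).support

/-- `σ(X_t, Y_t, Z_t)`. -/
abbrev presentSigma (t : ℤ) : MeasurableSpace Path :=
  MeasurableSpace.comap (fun w : Path => w t) inferInstance

lemma presentSigma_le (t : ℤ) : presentSigma t ≤ (inferInstance : MeasurableSpace Path) :=
  (measurable_pi_apply t).comap_le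

/-- The (first order) Markov property: for every `t`, `W_{t+1}` is conditionally independent of
`(W_s)_{s ≤ t}` given `W_t`. -/
def IsMarkov (P : Law) : Prop :=
  ∀ t : ℤ, CondIndepFun (presentSigma t) (presentSigma_le t)
    (fun w : Path => w (t + 1)) (fun (w : Path) (s : Set.Iic t) => w s) (P : Measure Path)

/-- `P` is the law of a series `(X, Y, Z)`, defined on some probability space together with noise
variables, such that `X_t = h_X(X_{t-1}, Y_{t-1}, Z_{t-1}, ε^X_t)` and
`Y_t = h_Y(X_{t-1}, Y_{t-1}, Z_{t-1}, ε^Y_t)` almost surely for all `t ∈ ℤ`, with measurable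
`h_X`, `h_Y` that do not depend on `t`, where the noise vectors `(ε^X_t, ε^Y_t)`, `t ∈ ℤ`, are
independent and identically distributed. -/
def IsStructurallyGenerated (P : Law) : Prop :=
  ∃ (Ω : Type) (_ : MeasurableSpace Ω) (Pr : Measure Ω) (_ : IsProbabilityMeasure Pr)
    (ξ υ ζ εX εY : ℤ → Ω → ℝ) (hX hY : ℝ × ℝ × ℝ × ℝ → ℝ),
    (∀ t, Measurable (ξ t)) ∧ (∀ t, Measurable (υ t)) ∧ (∀ t, Measurable (ζ t)) ∧
    (∀ t, Measurable (εX t)) ∧ (∀ t, Measurable (εY t)) ∧ Measurable hX ∧ Measurable hY ∧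
    Pr.map (fun ω t => (ξ t ω, υ t ω, ζ t ω)) = (P : Measure Path) ∧
    iIndepFun (fun t ω => (εX t ω, εY t ω)) Pr ∧
    (∀ s t, IdentDistrib (fun ω => (εX s ω, εY s ω)) (fun ω => (εX t ω, εY t ω)) Pr Pr) ∧
    (∀ t, ∀ᵐ ω ∂Pr, ξ t ω = hX (ξ (t - 1) ω, υ (t - 1) ω, ζ (t - 1) ω, εX t ω)) ∧
    (∀ t, ∀ᵐ ω ∂Pr, υ t ω = hY (ξ (t - 1) ω, υ (t - 1) ω, ζ (t - 1) ω, εY t ω))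

/-- The model class: laws of stationary, first order Markov, structurally generated univariate
series `X`, `Y`, `Z` with iid noise, continuous with respect to Lebesgue measure, with `X`, `Y`
supported on a neighbourhood of infinity. -/
def modelClass : Set Law :=
  {P | IsStationary P ∧ IsStructurallyGenerated P ∧ IsMarkov P ∧ IsContinuousLaw P ∧
    IsSupportedNearInfinity P}

/-- `F` is a distribution function on `ℝ` with `F x < 1` for every `x`. -/
structure IsUnboundedDistributionFunction (F : ℝ → ℝ) : Prop where
  mono : Monotone F
  right_continuous : ∀ x, ContinuousWithinAt F (Set.Ici x) x
  tendsto_atBot : Tendsto F atBot (𝓝 0)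
  tendsto_atTop : Tendsto F atTop (𝓝 1)
  lt_one : ∀ x, F x < 1

/-- The information `σ(Y_s, Z_s : s ≤ t)`. -/
abbrev infoWithoutX (t : ℤ) : MeasurableSpace Path :=
  MeasurableSpace.comap (fun (w : Path) (s : Set.Iic t) => (Y s w, Z s w)) inferInstance

/-- The regular conditional law of the path given `σ(Y_s, Z_s : s ≤ t)`. -/
noncomputable def condLaw (P : Law) (t : ℤ) (w : Path) : Measure Path :=
  condExpKernel (P : Measure Path) (infoWithoutX t) w

/-- `E[F(Y_{t+1}) | X_t > v, (Y_s, Z_s)_{s ≤ t}]` at the path `w`: the regular conditional law given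
`(Y_s, Z_s)_{s ≤ t}` is conditioned further on the event `X_t > v`. Meaningful only where that event
has positive conditional probability. -/
noncomputable def tailCondExp (P : Law) (F : ℝ → ℝ) (t : ℤ) (v : ℝ) (w : Path) : ℝ :=
  ∫ w', F (Y (t + 1) w') ∂(ProbabilityTheory.cond (condLaw P t w) {w' | v < X t w'})

/-- At the path `w`, the coefficient `Γ_{X → Y | Z} = lim_{v → ∞} E[F(Y_{t+1}) | X_t > v, …]` is well
defined (every conditioning event has positive conditional probability and the limit exists) and
equals `g`. -/
def HasTailCoefficient (P : Law) (F : ℝ → ℝ) (t : ℤ) (w : Path) (g : ℝ) : Prop :=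
  (∀ v : ℝ, condLaw P t w {w' | v < X t w'} ≠ 0) ∧
    Tendsto (fun v => tailCondExp P F t v w) atTop (𝓝 g)

/-- The null hypothesis: the laws of the model class for which, almost surely, the coefficient
`Γ_{X → Y | Z}` is well defined and smaller than `1`. -/
def nullClass (F : ℝ → ℝ) : Set Law :=
  {P | P ∈ modelClass ∧
    ∀ t : ℤ, ∀ᵐ w ∂(P : Measure Path), ∃ g : ℝ, HasTailCoefficient P F t w g ∧ g < 1}

/-- The alternatives: all laws of the model class outside the null hypothesis. -/
def alternativeClass (F : ℝ → ℝ) : Set Law := modelClass \ nullClass F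

/-- The probability, under `P`, that the test `ψ` rejects (takes the value `1`) when it is applied to
the sample `(X_i, Y_i, Z_i)`, `i = 1, …, n`. -/
noncomputable def rejectionProb {n : ℕ} (ψ : (Fin n → ℝ × ℝ × ℝ) → Fin 2) (P : Law) : ℝ≥0∞ :=
  (P : Measure Path) {w | ψ (fun i : Fin n => w (1 + (i : ℕ))) = 1}

end TailTesting

open MeasureTheory ProbabilityTheory Filter
open scoped Topology ENNReal

namespace TailTesting

/-! Every law `Q` of the model class is a limit of null laws in the sense of finite samples, so no
test has power above its size. With π the one-time marginal and `K` the transition kernel of `Q`,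
the approximating chain has kernel `(1 - ε) K₁ + ε ρ`. Here `K₁` agrees with `K` on a set `G ⊆ {x ≤
M}` of π-mass at least `1 - ε ^ 2` and equals `ρ` off `G`, while `ρ = (1 - ε) π + ε τ` with τ a
probability measure equivalent to Lebesgue measure.

The new chain satisfies the null. For `x > M` its kernel no longer depends on the state, so given
the past of `(Y, Z)` and `X_t > v ≥ M` the law of `W_{t+1}` is a fixed ν. The coefficient is then `∫
F dν`, which is below `1` because `F < 1` everywhere. The kernel is equivalent to Lebesgue measure,
and this yields the absolute continuity, the full supports, and the positive conditional probability
of all events `{X_t > v}` (`HasTransition.mem_nullClass`).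

The new chain exists and is structurally generated because refreshes from `ρ` forget the old state:
almost surely there is a last refresh, so the state is an explicit function of the iid noise since
then (`exists_law_hasTransition_refreshKernel`).

The new chain is close to `Q`. Replacing `K` by `K₁` costs `ε ^ 2` per step, and the refresh rate ε
limits the accumulation to order ε in the stationary law (`lintegral_stationary_le`). Each further
observation costs at most `ε + ε ^ 2` (`lintegral_window_le`). For a fixed sample size the total
vanishes with ε. -/

/-- The history `(W_s)_{s ≤ t}` of a path. -/
def history (t : ℤ) (w : Path) (s : Set.Iic t) : ℝ × ℝ × ℝ := w s

/-- The present value, read off the history. -/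
def present (t : ℤ) (h : Set.Iic t → ℝ × ℝ × ℝ) : ℝ × ℝ × ℝ := h ⟨t, Set.mem_Iic.2 le_rfl⟩

@[fun_prop]
lemma measurable_history (t : ℤ) : Measurable (history t) :=
  measurable_pi_lambda _ fun _ => measurable_pi_apply _

@[fun_prop]
lemma measurable_present (t : ℤ) : Measurable (present t) := measurable_pi_apply _

lemma present_history (t : ℤ) (w : Path) : present t (history t w) = w t := rfl

/-- `K` is a transition kernel of the path measure `μ`: at every time `t`, the conditional law of
`W_{t+1}` given the history `(W_s)_{s ≤ t}` is `K W_t`. -/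
def HasTransition (μ : Measure Path) (K : Kernel (ℝ × ℝ × ℝ) (ℝ × ℝ × ℝ)) : Prop :=
  ∀ t : ℤ, μ.map (fun w => (history t w, w (t + 1))) =
    μ.map (history t) ⊗ₘ K.comap (present t) (measurable_present t)

/-! ### Transition kernels and the Markov property. -/

section Transition

variable {μ : Measure Path} {K : Kernel (ℝ × ℝ × ℝ) (ℝ × ℝ × ℝ)}

lemma HasTransition.lintegral [IsProbabilityMeasure μ] [IsMarkovKernel K] (h : HasTransition μ K)
    (t : ℤ) {f : (Set.Iic t → ℝ × ℝ × ℝ) × (ℝ × ℝ × ℝ) → ℝ≥0∞} (hf : Measurable f) :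
    ∫⁻ w, f (history t w, w (t + 1)) ∂μ = ∫⁻ w, ∫⁻ y, f (history t w, y) ∂(K (w t)) ∂μ := by
  have h1 : ∫⁻ w, f (history t w, w (t + 1)) ∂μ =
      ∫⁻ p, f p ∂(μ.map (fun w => (history t w, w (t + 1)))) :=
    (lintegral_map hf (by fun_prop)).symm
  rw [h1, h t, Measure.lintegral_compProd hf, lintegral_map ?_ (measurable_history t)]
  · rfl
  · exact hf.lintegral_kernel_prod_right' (κ := K.comap (present t) (measurable_present t))

lemma HasTransition.lintegral_comp [IsProbabilityMeasure μ] [IsMarkovKernel K]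
    (h : HasTransition μ K) {γ : Type*} [MeasurableSpace γ] (t : ℤ)
    {φ : (Set.Iic t → ℝ × ℝ × ℝ) → γ} (hφ : Measurable φ)
    {f : γ × (ℝ × ℝ × ℝ) → ℝ≥0∞} (hf : Measurable f) :
    ∫⁻ w, f (φ (history t w), w (t + 1)) ∂μ =
      ∫⁻ w, ∫⁻ y, f (φ (history t w), y) ∂(K (w t)) ∂μ :=
  h.lintegral t (f := fun p => f (φ p.1, p.2)) (by fun_prop)

/-- Only the present matters for the next step, so the history may be replaced by any statistic `φ`
from which the present can be recovered (through `ψ`). -/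
lemma HasTransition.map_prod [IsProbabilityMeasure μ] [IsMarkovKernel K]
    (h : HasTransition μ K) {γ : Type*} [MeasurableSpace γ] (t : ℤ)
    {φ : (Set.Iic t → ℝ × ℝ × ℝ) → γ} (hφ : Measurable φ)
    {ψ : γ → ℝ × ℝ × ℝ} (hψ : Measurable ψ) (hψφ : ∀ a, ψ (φ a) = present t a) :
    μ.map (fun w => (φ (history t w), w (t + 1))) =
      μ.map (fun w => φ (history t w)) ⊗ₘ K.comap ψ hψ := by
  have hφ' : Measurable fun w => φ (history t w) := hφ.comp (measurable_history t)
  ext s hs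
  have hf : Measurable (s.indicator (1 : γ × (ℝ × ℝ × ℝ) → ℝ≥0∞)) := measurable_one.indicator hs
  rw [← lintegral_indicator_one hs, ← lintegral_indicator_one hs,
    lintegral_map hf (by fun_prop), h.lintegral_comp t hφ hf, Measure.lintegral_compProd hf,
    lintegral_map (hf.lintegral_kernel_prod_right' (κ := K.comap ψ hψ)) hφ']
  simp [Kernel.comap_apply, hψφ, present_history]

/-- The conditional laws of `W_{t+1}` given `(W_t, history)` and given `W_t` alone are both `K W_t`,
and equality of the two is conditional independence. -/
lemma HasTransition.isMarkov {P : Law} [IsMarkovKernel K] (h : HasTransition P K) :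
    IsMarkov P := by
  intro t
  refine CondIndepFun.symm ?_
  have hk : Measurable fun w : Path => w t := measurable_pi_apply t
  have hf : Measurable fun w : Path => w (t + 1) := measurable_pi_apply _
  refine (condIndepFun_iff_condDistrib_prod_ae_eq_prodMkRight (k := fun w : Path => w t)
    hf (measurable_history t) hk).2 ?_
  have h1 := condDistrib_ae_eq_of_measure_eq_compProd (μ := (P : Measure Path))
    (fun w : Path => (w t, history t w)) hf.aemeasurable (h.map_prod t
      (φ := fun a => (present t a, a)) (by fun_prop) measurable_fst fun a => rfl)
  have h2 := condDistrib_ae_eq_of_measure_eq_compProd (μ := (P : Measure Path))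
    (fun w : Path => w t) hf.aemeasurable (h.map_prod t
      (φ := present t) (by fun_prop) measurable_id fun a => rfl)
  have h3 : (P : Measure Path).map (fun w => w t) =
      ((P : Measure Path).map (fun w : Path => (w t, history t w))).map Prod.fst := by
    rw [Measure.map_map measurable_fst (by fun_prop)]; rfl
  rw [h3] at h2
  have h4 := ae_of_ae_map measurable_fst.aemeasurable h2
  filter_upwards [h1, h4] with a ha hb
  rw [ha, Kernel.prodMkRight_apply, hb]
  rfl

/-- The transition kernel of a stationary law. -/
noncomputable def transitionKernel (Q : Law) : Kernel (ℝ × ℝ × ℝ) (ℝ × ℝ × ℝ) :=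
  condDistrib (fun w : Path => w 1) (fun w : Path => w 0) (Q : Measure Path)

instance (Q : Law) : IsMarkovKernel (transitionKernel Q) := by
  unfold transitionKernel; infer_instance

lemma IsStationary.map_eq {Q : Law} (hQ : IsStationary Q) {γ : Type*} [MeasurableSpace γ]
    {φ : Path → γ} (hφ : Measurable φ) (s : ℤ) :
    (Q : Measure Path).map (fun w => φ (fun t => w (t + s))) = (Q : Measure Path).map φ := by
  conv_rhs => rw [← hQ s]
  rw [Measure.map_map hφ (by fun_prop)]
  rfl

/-- Stationarity carries the kernel from time `0` to time `t`, and the Markov property allows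
conditioning on the whole history. The extra copy of `W_t` next to the history is then projected
away. -/
lemma hasTransition_transitionKernel {Q : Law} (hs : IsStationary Q) (hM : IsMarkov Q) :
    HasTransition Q (transitionKernel Q) := by
  intro t
  have hk : Measurable fun w : Path => w t := measurable_pi_apply t
  have hf : Measurable fun w : Path => w (t + 1) := measurable_pi_apply _
  have h0 : Measurable fun w : Path => w 0 := measurable_pi_apply _
  have h1 : Measurable fun w : Path => w 1 := measurable_pi_apply _
  have hpair := compProd_map_condDistrib (μ := (Q : Measure Path)) (X := fun w : Path => w 0) (mβ := inferInstance)
    h1.aemeasurable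
  have e1 := hs.map_eq (φ := fun w => (w 0, w 1)) (by fun_prop) t
  have e2 := hs.map_eq h0 t
  simp only [zero_add, add_comm (1 : ℤ) t] at e1 e2
  rw [← e1, ← e2] at hpair
  have hK : condDistrib (fun w : Path => w (t + 1)) (fun w : Path => w t) (Q : Measure Path)
      =ᵐ[(Q : Measure Path).map (fun w => w t)] transitionKernel Q :=
    condDistrib_ae_eq_of_measure_eq_compProd _ hf.aemeasurable hpair.symm
  have hci := (condIndepFun_iff_condDistrib_prod_ae_eq_prodMkRight (k := fun w : Path => w t)
    hf (measurable_history t) hk).1 (hM t).symm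
  have h3 : (Q : Measure Path).map (fun w => w t) =
      ((Q : Measure Path).map (fun w : Path => (w t, history t w))).map Prod.fst := by
    rw [Measure.map_map measurable_fst (by fun_prop)]; rfl
  rw [h3] at hK
  have hci' : condDistrib (fun w : Path => w (t + 1)) (fun w : Path => (w t, history t w))
      (Q : Measure Path) =ᵐ[(Q : Measure Path).map (fun w : Path => (w t, history t w))]
      Kernel.prodMkRight (Set.Iic t → ℝ × ℝ × ℝ) (transitionKernel Q) := by
    filter_upwards [hci, ae_of_ae_map measurable_fst.aemeasurable hK] with a ha hb
    rw [ha, Kernel.prodMkRight_apply, hb, Kernel.prodMkRight_apply]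
  have key := (condDistrib_ae_eq_iff_measure_eq_compProd _ hf.aemeasurable _).1 hci'
  have h5 : (Q : Measure Path).map (fun w => (history t w, w (t + 1))) =
      ((Q : Measure Path).map (fun w : Path => ((w t, history t w), w (t + 1)))).map
        (fun p => (p.1.2, p.2)) := by
    rw [Measure.map_map (by fun_prop) (by fun_prop)]; rfl
  rw [h5, key]
  ext s hs
  have hφ' : Measurable fun w : Path => (w t, history t w) := by fun_prop
  have hi : Measurable (s.indicator (1 : (Set.Iic t → ℝ × ℝ × ℝ) × (ℝ × ℝ × ℝ) → ℝ≥0∞)) :=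
    measurable_one.indicator hs
  have hi' : Measurable fun p : ((ℝ × ℝ × ℝ) × (Set.Iic t → ℝ × ℝ × ℝ)) × (ℝ × ℝ × ℝ) =>
    s.indicator (1 : (Set.Iic t → ℝ × ℝ × ℝ) × (ℝ × ℝ × ℝ) → ℝ≥0∞) (p.1.2, p.2) := by fun_prop
  rw [← lintegral_indicator_one hs, ← lintegral_indicator_one hs,
    lintegral_map hi (by fun_prop), Measure.lintegral_compProd hi', Measure.lintegral_compProd hi,
    lintegral_map (hi'.lintegral_kernel_prod_right'
      (κ := Kernel.prodMkRight (Set.Iic t → ℝ × ℝ × ℝ) (transitionKernel Q))) hφ',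
    lintegral_map (hi.lintegral_kernel_prod_right'
      (κ := (transitionKernel Q).comap (present t) (measurable_present t))) (measurable_history t)]
  rfl

end Transition

/-! ### Stationary solutions of recursions with refreshes. -/

section Recursion

variable {N : Type} (G : N → ℝ × ℝ × ℝ → ℝ × ℝ × ℝ) (R : Set N)

/-- The state at time `t` of the recursion `W_s = G (e_s) W_{s-1}`, started `k` steps before. -/
def iterateFrom : ℕ → ℤ → (ℤ → N) → ℝ × ℝ × ℝ
  | 0, _, _ => 0
  | k + 1, t, e => G (e t) (iterateFrom k (t - 1) e)

/-- The time elapsed since the last refresh (noise in `R`), zero if there was none. -/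
noncomputable def sinceRefresh (t : ℤ) (e : ℤ → N) : ℕ := sInf {k : ℕ | e (t - k) ∈ R}

lemma sinceRefresh_spec {t : ℤ} {e : ℤ → N} (h : ∃ j : ℕ, e (t - j) ∈ R) :
    e (t - sinceRefresh R t e) ∈ R :=
  Nat.sInf_mem (s := {k : ℕ | e (t - k) ∈ R}) h

lemma sinceRefresh_le {t : ℤ} {e : ℤ → N} {j : ℕ} (h : e (t - j) ∈ R) :
    sinceRefresh R t e ≤ j :=
  Nat.sInf_le h

/-- The stationary solution of the recursion `W_t = G (e_t) W_{t-1}`, where the noise values in `R`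
make the new state independent of the old one. -/
noncomputable def solution (e : ℤ → N) (t : ℤ) : ℝ × ℝ × ℝ :=
  iterateFrom G (sinceRefresh R t e + 1) t e

variable {G R}

/-- If `t + 1` is a refresh, `G` ignores the previous state and any starting value will do.
Otherwise the last refresh is unchanged and the elapsed time grows by one. -/
lemma solution_rec (hG : ∀ e ∈ R, ∀ w w', G e w = G e w') {t : ℤ} {e : ℤ → N}
    (h : ∃ j : ℕ, e (t - j) ∈ R) :
    solution G R e (t + 1) = G (e (t + 1)) (solution G R e t) := by
  have h1 : solution G R e (t + 1) =
      G (e (t + 1)) (iterateFrom G (sinceRefresh R (t + 1) e) (t + 1 - 1) e) := rfl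
  rw [h1, add_sub_cancel_right]
  by_cases ht : e (t + 1) ∈ R
  · exact hG _ ht _ _
  · have h2 : sinceRefresh R (t + 1) e = sinceRefresh R t e + 1 := by
      have hs := sinceRefresh_spec R h
      have hs' : e (t + 1 - ((sinceRefresh R t e + 1 : ℕ) : ℤ)) ∈ R := by
        convert hs using 2; push_cast; ring
      refine le_antisymm (sinceRefresh_le R hs') ?_
      have hr := sinceRefresh_spec R ⟨_, hs'⟩
      cases hk : sinceRefresh R (t + 1) e with
      | zero => rw [hk] at hr; exact absurd (by simpa using hr) ht
      | succ k =>
        rw [hk] at hr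
        have : e (t - (k : ℤ)) ∈ R := by convert hr using 2; push_cast; ring
        have := sinceRefresh_le R this
        omega
    rw [h2]; rfl

lemma iterateFrom_congr (k : ℕ) {t : ℤ} {e e' : ℤ → N} (h : ∀ s ≤ t, e s = e' s) :
    iterateFrom G k t e = iterateFrom G k t e' := by
  induction k generalizing t with
  | zero => rfl
  | succ k ih =>
    simp only [iterateFrom]
    rw [h t le_rfl, ih fun s hs => h s (by omega)]

lemma sinceRefresh_congr {t : ℤ} {e e' : ℤ → N} (h : ∀ s ≤ t, e s = e' s) :
    sinceRefresh R t e = sinceRefresh R t e' := by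
  have : ∀ k : ℕ, e (t - k) = e' (t - k) := fun k => h _ (by omega)
  unfold sinceRefresh
  simp only [this]

lemma solution_congr {t : ℤ} {e e' : ℤ → N} (h : ∀ s ≤ t, e s = e' s) :
    solution G R e t = solution G R e' t := by
  unfold solution
  rw [sinceRefresh_congr h, iterateFrom_congr _ h]

lemma iterateFrom_shift (k : ℕ) (t s : ℤ) (e : ℤ → N) :
    iterateFrom G k t (fun u => e (u + s)) = iterateFrom G k (t + s) e := by
  induction k generalizing t with
  | zero => rfl
  | succ k ih =>
    simp only [iterateFrom]
    rw [ih, show t - 1 + s = t + s - 1 by ring]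

lemma solution_shift (t s : ℤ) (e : ℤ → N) :
    solution G R (fun u => e (u + s)) t = solution G R e (t + s) := by
  have : sinceRefresh R t (fun u => e (u + s)) = sinceRefresh R (t + s) e := by
    unfold sinceRefresh
    have : ∀ k : ℕ, t - (k : ℤ) + s = t + s - k := fun k => by ring
    simp only [this]
  unfold solution
  rw [this, iterateFrom_shift]

variable [MeasurableSpace N]

lemma measurable_iterateFrom (hGm : Measurable fun p : N × (ℝ × ℝ × ℝ) => G p.1 p.2)
    (k : ℕ) (t : ℤ) : Measurable (iterateFrom G k t) := by
  induction k generalizing t with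
  | zero => exact measurable_const
  | succ k ih =>
    have := ih (t - 1)
    exact hGm.comp ((measurable_pi_apply t).prodMk this)

lemma measurable_sinceRefresh (hR : MeasurableSet R) (t : ℤ) :
    Measurable (sinceRefresh R t) := by
  classical
  have h1 (k : ℕ) : MeasurableSet {e : ℤ → N | e (t - k) ∈ R} := measurable_pi_apply _ hR
  -- The second alternative makes the search succeed at `0` when there is no refresh, matching the
  -- value of `sInf ∅` in `ℕ`.
  have hex (e : ℤ → N) : ∃ k : ℕ, e (t - k) ∈ R ∨ e ∉ ⋃ j : ℕ, {e : ℤ → N | e (t - j) ∈ R} := by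
    by_cases h : ∃ j : ℕ, e (t - j) ∈ R
    · exact h.imp fun j hj => Or.inl hj
    · exact ⟨0, Or.inr (by simpa using h)⟩
  have heq : sinceRefresh R t = fun e => Nat.find (hex e) := by
    funext e
    symm
    rw [Nat.find_eq_iff]
    by_cases h : ∃ j : ℕ, e (t - j) ∈ R
    · refine ⟨Or.inl (sinceRefresh_spec R h), fun n hn hn' => ?_⟩
      rcases hn' with hn' | hn'
      · exact absurd (sinceRefresh_le R hn') (not_le.2 hn)
      · exact hn' (Set.mem_iUnion.2 h)
    · have h0 : sinceRefresh R t e = 0 := by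
        unfold sinceRefresh
        rw [Nat.sInf_eq_zero]
        exact Or.inr (Set.eq_empty_of_forall_notMem fun k hk => h ⟨k, hk⟩)
      rw [h0]
      exact ⟨Or.inr (by simpa using h), fun n hn => absurd hn (Nat.not_lt_zero n)⟩
  rw [heq]
  exact measurable_find hex fun k => (h1 k).union (MeasurableSet.iUnion h1).compl

lemma measurable_solution (hGm : Measurable fun p : N × (ℝ × ℝ × ℝ) => G p.1 p.2)
    (hR : MeasurableSet R) : Measurable (solution G R) := by
  refine measurable_pi_lambda _ fun t => ?_
  have h : Measurable fun p : (ℤ → N) × ℕ => iterateFrom G p.2 t p.1 :=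
    measurable_from_prod_countable_left fun k => measurable_iterateFrom hGm k t
  exact h.comp (measurable_id.prodMk ((measurable_sinceRefresh hR t).add_const 1))

variable {ν : Measure N} [IsProbabilityMeasure ν]

/-- The absence of refreshes during `m` given steps has probability `ν Rᶜ ^ m`, which tends to `0`.
-/
lemma ae_exists_refresh (hR : MeasurableSet R) (hνR : ν R ≠ 0) (t : ℤ) :
    ∀ᵐ e ∂(Measure.infinitePi fun _ : ℤ => ν), ∃ j : ℕ, e (t - j) ∈ R := by
  have hlt : ν Rᶜ < 1 := by
    rw [prob_compl_eq_one_sub hR]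
    exact ENNReal.sub_lt_self ENNReal.one_ne_top one_ne_zero hνR
  have hle (m : ℕ) : (Measure.infinitePi fun _ : ℤ => ν) {e | ¬ ∃ j : ℕ, e (t - j) ∈ R}
      ≤ ν Rᶜ ^ m := by
    have hpi := Measure.infinitePi_pi (fun _ : ℤ => ν) (s := Finset.Ioc (t - m) t)
      (t := fun _ => Rᶜ) fun _ _ => hR.compl
    rw [Finset.prod_const, Int.card_Ioc, show (t - (t - (m : ℤ))).toNat = m by simp] at hpi
    rw [← hpi]
    refine measure_mono fun e he i hi hiR => he ⟨(t - i).toNat, ?_⟩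
    simp only [Finset.coe_Ioc, Set.mem_Ioc] at hi
    rwa [show t - ((t - i).toNat : ℤ) = i by omega]
  refine le_antisymm ?_ zero_le
  exact ge_of_tendsto' (ENNReal.tendsto_pow_atTop_nhds_zero_of_lt_one hlt) hle

lemma indepFun_past_next (t : ℤ) :
    IndepFun (fun (e : ℤ → N) (s : Set.Iic t) => e s) (fun e => e (t + 1))
      (Measure.infinitePi fun _ : ℤ => ν) := by
  have hi : iIndepFun (fun (s : ℤ) (e : ℤ → N) => e s) (Measure.infinitePi fun _ : ℤ => ν) :=
    iIndepFun_infinitePi (X := fun _ x => x) fun _ => measurable_id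
  have hd : Disjoint (Set.Iic t) {t + 1} := by simp
  have := indep_iSup_of_disjoint (fun s => (measurable_pi_apply s).comap_le) hi hd
  rw [IndepFun_iff_Indep]
  refine indep_of_indep_of_le_left (indep_of_indep_of_le_right this ?_) ?_
  · simp
  · rw [MeasurableSpace.pi, MeasurableSpace.comap_iSup]
    refine iSup_le fun s => ?_
    rw [MeasurableSpace.comap_comp]
    exact le_iSup₂_of_le s.1 s.2 le_rfl

/-- The law of the stationary solution for iid noise with law `ν`. -/
noncomputable def solutionLaw (hGm : Measurable fun p : N × (ℝ × ℝ × ℝ) => G p.1 p.2)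
    (hR : MeasurableSet R) (ν : Measure N) [IsProbabilityMeasure ν] : Law :=
  ⟨(Measure.infinitePi fun _ : ℤ => ν).map (solution G R),
    Measure.isProbabilityMeasure_map (measurable_solution hGm hR).aemeasurable⟩

variable (hGm : Measurable fun p : N × (ℝ × ℝ × ℝ) => G p.1 p.2) (hR : MeasurableSet R)

include hGm hR

lemma coe_solutionLaw : (solutionLaw hGm hR ν : Measure Path) =
    (Measure.infinitePi fun _ : ℤ => ν).map (solution G R) := rfl

/-- The solution commutes with time shifts, and the product measure is shift invariant. -/
lemma isStationary_solutionLaw : IsStationary (solutionLaw hGm hR ν) := by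
  intro s
  have hm := measurable_solution hGm hR
  rw [coe_solutionLaw, Measure.map_map (by fun_prop) hm]
  have h1 : (fun (w : Path) (t : ℤ) => w (t + s)) ∘ solution G R =
      solution G R ∘ fun e u => e (u + s) := by
    funext e t
    exact (solution_shift t s e).symm
  have h2 := Measure.map_infinitePi_infinitePi_of_inj (P := fun _ : ℤ => ν)
    (f := fun u : ℤ => u + s) (add_left_injective s)
  rw [h1, ← Measure.map_map hm (by fun_prop), h2]

lemma isStructurallyGenerated_solutionLaw [StandardBorelSpace N]
    (hG : ∀ e ∈ R, ∀ w w', G e w = G e w') (hνR : ν R ≠ 0) :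
    IsStructurallyGenerated (solutionLaw hGm hR ν) := by
  have : Nonempty N := ν.nonempty_of_neZero
  have hm := measurable_solution hGm hR
  have hmt (t : ℤ) : Measurable fun e => solution G R e t := (measurable_pi_apply t).comp hm
  have hemb := measurableEmbedding_embeddingReal N
  have hinv : Measurable hemb.invFun := hemb.measurable_invFun
  have hh : Measurable fun p : ℝ × ℝ × ℝ × ℝ =>
      G (hemb.invFun p.2.2.2) (p.1, p.2.1, p.2.2.1) :=
    hGm.comp ((hinv.comp (by fun_prop)).prodMk (by fun_prop))
  have hleft (n : N) : hemb.invFun (embeddingReal N n) = n := hemb.leftInverse_invFun n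
  have hrec (t : ℤ) : ∀ᵐ e ∂(Measure.infinitePi fun _ : ℤ => ν),
      solution G R e t = G (e t) (solution G R e (t - 1)) := by
    filter_upwards [ae_exists_refresh hR hνR (t - 1)] with e he
    simpa using solution_rec hG he
  -- The same real encoding of `e t` serves as noise for both `X` and `Y`: independence is required
  -- over time, not between the two components.
  refine ⟨ℤ → N, inferInstance, Measure.infinitePi fun _ : ℤ => ν, inferInstance,
    fun t e => (solution G R e t).1, fun t e => (solution G R e t).2.1,
    fun t e => (solution G R e t).2.2, fun t e => embeddingReal N (e t),
    fun t e => embeddingReal N (e t),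
    fun p => (G (hemb.invFun p.2.2.2) (p.1, p.2.1, p.2.2.1)).1,
    fun p => (G (hemb.invFun p.2.2.2) (p.1, p.2.1, p.2.2.1)).2.1,
    fun t => (hmt t).fst, fun t => (hmt t).snd.fst, fun t => (hmt t).snd.snd,
    fun t => by fun_prop, fun t => by fun_prop, hh.fst, hh.snd.fst, rfl, ?_, ?_, ?_, ?_⟩
  · exact iIndepFun_infinitePi (X := fun _ n => (embeddingReal N n, embeddingReal N n))
      fun _ => by fun_prop
  · intro s t
    refine ⟨by fun_prop, by fun_prop, ?_⟩
    have (t : ℤ) : (Measure.infinitePi fun _ : ℤ => ν).map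
        (fun e => (embeddingReal N (e t), embeddingReal N (e t))) =
        ν.map fun n => (embeddingReal N n, embeddingReal N n) := by
      conv_rhs => rw [← Measure.infinitePi_map_eval (fun _ : ℤ => ν) t]
      rw [Measure.map_map (by fun_prop) (by fun_prop)]
      rfl
    rw [this, this]
  · intro t
    filter_upwards [hrec t] with e he
    simp only [hleft]
    exact congrArg Prod.fst he
  · intro t
    filter_upwards [hrec t] with e he
    simp only [hleft]
    exact congrArg (fun p => p.2.1) he

/-- The history up to `t` is a function of the noise up to `t`, hence independent of `e (t + 1)`,
which produces the next state through `G`. -/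
lemma hasTransition_solutionLaw {K : Kernel (ℝ × ℝ × ℝ) (ℝ × ℝ × ℝ)} [IsMarkovKernel K]
    (hG : ∀ e ∈ R, ∀ w w', G e w = G e w') (hνR : ν R ≠ 0)
    (hK : ∀ w, K w = ν.map fun n => G n w) :
    HasTransition (solutionLaw hGm hR ν) K := by
  intro t
  obtain ⟨n₀⟩ : Nonempty N := ν.nonempty_of_neZero
  have hm := measurable_solution hGm hR
  have hh : Measurable fun e => history t (solution G R e) := (measurable_history t).comp hm
  rw [coe_solutionLaw, Measure.map_map (by fun_prop) hm, Measure.map_map (by fun_prop) hm]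
  -- Past noise is padded by the constant `n₀` after `t`; by causality the solution up to `t` does
  -- not see the padding.
  have hext : Measurable fun (p : Set.Iic t → N) (s : ℤ) =>
      if h : s ∈ Set.Iic t then p ⟨s, h⟩ else n₀ := by
    refine measurable_pi_lambda _ fun s => ?_
    by_cases h : s ∈ Set.Iic t
    · simp only [h, dite_true]; exact measurable_pi_apply _
    · simp only [h, dite_false]; exact measurable_const
  have hfac : (fun e => history t (solution G R e)) =
      (fun p : Set.Iic t → N => history t (solution G R
        fun s : ℤ => if h : s ∈ Set.Iic t then p ⟨s, h⟩ else n₀)) ∘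
      (fun (e : ℤ → N) (s : Set.Iic t) => e s) := by
    funext e s
    change solution G R e s =
      solution G R (fun u : ℤ => if _ : u ∈ Set.Iic t then e u else n₀) s
    refine solution_congr fun u hu => ?_
    have : u ≤ t := hu.trans s.2
    simp [this]
  have hind : IndepFun (fun e => history t (solution G R e)) (fun e => e (t + 1))
      (Measure.infinitePi fun _ : ℤ => ν) := by
    rw [hfac]
    exact (indepFun_past_next t).comp (φ := _) (ψ := id) (hh.comp hext) measurable_id
  rw [indepFun_iff_map_prod_eq_prod_map_map hh.aemeasurable (measurable_pi_apply _).aemeasurable,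
    Measure.infinitePi_map_eval] at hind
  have hmap : (Measure.infinitePi fun _ : ℤ => ν).map
      ((fun w => (history t w, w (t + 1))) ∘ solution G R) =
      ((Measure.infinitePi fun _ : ℤ => ν).map
        (fun e => (history t (solution G R e), e (t + 1)))).map
      (fun p => (p.1, G p.2 (present t p.1))) := by
    rw [Measure.map_map ?_ (hh.prodMk (by fun_prop))]
    · refine Measure.map_congr ?_
      filter_upwards [ae_exists_refresh hR hνR t] with e he
      simp only [Function.comp_apply, solution_rec hG he, present_history]
    · exact measurable_fst.prodMk
        (hGm.comp (measurable_snd.prodMk ((measurable_present t).comp measurable_fst)))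
  have hG2 : Measurable fun p : (Set.Iic t → ℝ × ℝ × ℝ) × N =>
      (p.1, G p.2 (present t p.1)) := measurable_fst.prodMk
        (hGm.comp (measurable_snd.prodMk ((measurable_present t).comp measurable_fst)))
  rw [hmap, hind]
  ext s hs
  rw [Measure.map_apply hG2 hs, Measure.prod_apply (hG2 hs), Measure.compProd_apply hs]
  refine lintegral_congr fun h => ?_
  have hGh : Measurable fun n => G n (present t h) := hGm.comp measurable_prodMk_right
  rw [Kernel.comap_apply, hK, Measure.map_apply hGh
    (measurable_prodMk_left hs)]
  rfl

end Recursion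

/-! ### Densities, supports and tail events for kernels equivalent to Lebesgue measure. -/

section Properties

variable {P : Law} {K : Kernel (ℝ × ℝ × ℝ) (ℝ × ℝ × ℝ)} [IsMarkovKernel K]

lemma map_snoc_volume (m : ℕ) :
    ((volume : Measure (Fin m → ℝ × ℝ × ℝ)).prod (volume : Measure (ℝ × ℝ × ℝ))).map
      (fun p => (Fin.snoc p.1 p.2 : Fin (m + 1) → ℝ × ℝ × ℝ)) = volume := by
  have h := (volume_preserving_piFinSuccAbove (fun _ : Fin (m + 1) => ℝ × ℝ × ℝ)
    (Fin.last m)).symm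
  have h2 := (Measure.measurePreserving_swap (μ := (volume : Measure (Fin m → ℝ × ℝ × ℝ)))
    (ν := (volume : Measure (ℝ × ℝ × ℝ))))
  have h3 := h.comp h2
  rw [← h3.map_eq]
  congr 1
  funext p
  simp [MeasurableEquiv.piFinSuccAbove, Fin.insertNthEquiv]

lemma measurable_snoc (m : ℕ) : Measurable fun p : (Fin m → ℝ × ℝ × ℝ) × (ℝ × ℝ × ℝ) =>
    (Fin.snoc p.1 p.2 : Fin (m + 1) → ℝ × ℝ × ℝ) := by
  refine measurable_pi_lambda _ fun i => ?_
  refine Fin.lastCases ?_ (fun j => ?_) i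
  · simpa using measurable_snd
  · simp only [Fin.snoc_castSucc]; fun_prop

lemma window_succ (t : ℤ) (m : ℕ) (w : Path) :
    (fun i : Fin (m + 1) => w (t + 1 + (i : ℕ))) =
      Fin.snoc (fun i : Fin m => w (t + 1 + (i : ℕ))) (w (t + m + 1)) := by
  funext i
  refine Fin.lastCases ?_ (fun j => ?_) i
  · simp only [Fin.snoc_last, Fin.val_last]; congr 1; ring
  · simp [Fin.snoc_castSucc]

/-- The window `(W_{t+1}, …, W_{t+m})`, read off the history up to time `t + m`. -/
def windowOfHistory (t : ℤ) (m : ℕ) (h : Set.Iic (t + m) → ℝ × ℝ × ℝ) (i : Fin m) : ℝ × ℝ × ℝ :=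
  h ⟨t + 1 + (i : ℕ), by have := i.2; simp only [Set.mem_Iic]; omega⟩

lemma measurable_windowOfHistory (t : ℤ) (m : ℕ) : Measurable (windowOfHistory t m) :=
  measurable_pi_lambda _ fun _ => measurable_pi_apply _

lemma HasTransition.map_prod_absolutelyContinuous (h : HasTransition P K)
    (hac : ∀ w, K w ≪ volume) {γ : Type*} [MeasurableSpace γ] (t : ℤ)
    {φ : (Set.Iic t → ℝ × ℝ × ℝ) → γ} (hφ : Measurable φ) :
    (P : Measure Path).map (fun w => (φ (history t w), w (t + 1))) ≪
      ((P : Measure Path).map (fun w => φ (history t w))).prod volume := by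
  have hφ' : Measurable fun w => φ (history t w) := hφ.comp (measurable_history t)
  have hp : Measurable fun w : Path => (φ (history t w), w t) := by fun_prop
  have h1 := h.map_prod t (φ := fun a => (φ a, present t a)) (by fun_prop) measurable_snd
    fun a => rfl
  have h2 : (P : Measure Path).map (fun w => ((φ (history t w), w t), w (t + 1))) ≪
      ((P : Measure Path).map (fun w => (φ (history t w), w t))).prod volume := by
    rw [← Measure.compProd_const]
    refine h1.absolutelyContinuous.trans (Measure.AbsolutelyContinuous.compProd_right ?_)
    exact ae_of_all _ fun a => hac a.2
  have h3 := h2.map (f := Prod.map Prod.fst id) (by fun_prop)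
  rw [Measure.map_map (by fun_prop) (by fun_prop), ← Measure.map_prod_map _ _ (by fun_prop)
    (by fun_prop), Measure.map_map (by fun_prop) hp, Measure.map_id] at h3
  exact h3

/-- Induction on the window length: the appended observation has a density conditionally on the
whole history. -/
lemma HasTransition.isContinuousLaw (h : HasTransition P K) (hac : ∀ w, K w ≪ volume) :
    IsContinuousLaw P := by
  intro t m
  induction m with
  | zero =>
    intro s hs
    have : s = ∅ := by
      rcases s.eq_empty_or_nonempty with h | ⟨x, hx⟩
      · exact h
      · have : s = Set.univ := Set.eq_univ_of_forall fun y => Subsingleton.elim x y ▸ hx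
        rw [this] at hs
        simp [volume_pi] at hs
    simp [this]
  | succ m ih =>
    have h1 := (h.map_prod_absolutelyContinuous hac (t + m)
      (measurable_windowOfHistory t m)).trans (ih.prod Measure.AbsolutelyContinuous.rfl)
    have hw : Measurable fun w : Path => windowOfHistory t m (history (t + m) w) :=
      (measurable_windowOfHistory t m).comp (measurable_history _)
    have h2 := h1.map (measurable_snoc m)
    rw [map_snoc_volume, Measure.map_map (measurable_snoc m) (by fun_prop)] at h2
    rw [show (fun (w : Path) (i : Fin (m + 1)) => w (t + 1 + (i : ℕ))) = fun w =>
      Fin.snoc (fun i : Fin m => w (t + 1 + (i : ℕ))) (w (t + m + 1)) from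
        funext (window_succ t m)]
    exact h2

lemma HasTransition.measure_next (h : HasTransition P K) (t : ℤ)
    {T : Set ((Set.Iic t → ℝ × ℝ × ℝ) × (ℝ × ℝ × ℝ))} (hT : MeasurableSet T) :
    (P : Measure Path) {w | (history t w, w (t + 1)) ∈ T} =
      ∫⁻ w, K (w t) (Prod.mk (history t w) ⁻¹' T) ∂(P : Measure Path) := by
  have e := h.lintegral t (measurable_one.indicator hT)
  have h1 : ∀ w : Path, ∫⁻ y, T.indicator 1 (history t w, y) ∂(K (w t)) =
      K (w t) (Prod.mk (history t w) ⁻¹' T) := fun w =>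
    lintegral_indicator_one (measurable_prodMk_left hT)
  simp only [h1] at e
  have hm : Measurable fun w : Path => (history t w, w (t + 1)) := by fun_prop
  rw [← e, ← lintegral_indicator_one (show MeasurableSet
    {w : Path | (history t w, w (t + 1)) ∈ T} from hm hT)]
  rfl

lemma HasTransition.measurable_next (t : ℤ)
    {T : Set ((Set.Iic t → ℝ × ℝ × ℝ) × (ℝ × ℝ × ℝ))} (hT : MeasurableSet T) :
    Measurable fun w : Path => K (w t) (Prod.mk (history t w) ⁻¹' T) :=
  (Kernel.measurable_kernel_prodMk_left (κ := K.comap (present t) (measurable_present t))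
    hT).comp (measurable_history t)

lemma HasTransition.isSupportedNearInfinity (h : HasTransition P K)
    (hpos : ∀ w, volume ≪ K w) : IsSupportedNearInfinity P := by
  have key (t : ℤ) {φ : ℝ × ℝ × ℝ → ℝ} (hφ : Continuous φ) (hsurj : Function.Surjective φ) :
      ((P : Measure Path).map fun w => φ (w t)).support = Set.univ := by
    have hφm : Measurable fun w : Path => φ (w t) := hφ.measurable.comp (measurable_pi_apply t)
    have : ((P : Measure Path).map fun w => φ (w t)).IsOpenPosMeasure := by
      refine ⟨fun U hU hne h0 => ?_⟩
      rw [Measure.map_apply hφm hU.measurableSet] at h0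
      obtain ⟨s, rfl⟩ : ∃ s, t = s + 1 := ⟨t - 1, by ring⟩
      have hT : MeasurableSet {p : (Set.Iic s → ℝ × ℝ × ℝ) × (ℝ × ℝ × ℝ) | φ p.2 ∈ U} :=
        (hφ.measurable.comp measurable_snd) hU.measurableSet
      have e := h.measure_next s hT
      rw [show (P : Measure Path) {w | (history s w, w (s + 1)) ∈
        {p : (Set.Iic s → ℝ × ℝ × ℝ) × (ℝ × ℝ × ℝ) | φ p.2 ∈ U}} = 0 from h0, eq_comm,
        lintegral_eq_zero_iff (HasTransition.measurable_next s hT)] at e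
      obtain ⟨w, hw⟩ := e.exists
      have h1 : volume (φ ⁻¹' U) = 0 := hpos _ hw
      obtain ⟨x, hx⟩ := hne
      obtain ⟨y, rfl⟩ := hsurj x
      exact (hU.preimage hφ).measure_ne_zero volume ⟨y, hx⟩ h1
    exact Measure.support_eq_univ
  intro t
  refine ⟨0, ?_, ?_⟩
  · have := key t (φ := fun p => p.1) (by fun_prop) fun x => ⟨(x, 0, 0), rfl⟩
    rw [show X t = fun w => (w t).1 from rfl, this]
    exact Set.subset_univ _
  · have := key t (φ := fun p => p.2.1) (by fun_prop) fun x => ⟨(0, x, 0), rfl⟩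
    rw [show Y t = fun w => (w t).2.1 from rfl, this]
    exact Set.subset_univ _

lemma infoWithoutX_le (t : ℤ) : infoWithoutX t ≤ (inferInstance : MeasurableSpace Path) := by
  refine Measurable.comap_le (measurable_pi_lambda _ fun s => ?_)
  have : Measurable fun w : Path => w s := measurable_pi_apply _
  exact this.snd.fst.prodMk this.snd.snd

/-- The history of `(Y, Z)` up to `t + 1`, from the history up to `t` and the next state. -/
noncomputable def extendYZ (t : ℤ) (p : (Set.Iic t → ℝ × ℝ × ℝ) × (ℝ × ℝ × ℝ))
    (s : Set.Iic (t + 1)) : ℝ × ℝ :=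
  if h : s.1 ≤ t then (p.1 ⟨s.1, h⟩).2 else p.2.2

lemma measurable_extendYZ (t : ℤ) : Measurable (extendYZ t) := by
  refine measurable_pi_lambda _ fun s => ?_
  by_cases h : s.1 ≤ t
  · simp only [extendYZ, h, dite_true]
    exact ((measurable_pi_apply _).comp measurable_fst).snd
  · simp only [extendYZ, h, dite_false]
    exact measurable_snd.snd

lemma extendYZ_history (t : ℤ) (w : Path) : extendYZ t (history t w, w (t + 1)) =
    fun s : Set.Iic (t + 1) => (Y s w, Z s w) := by
  funext s
  by_cases h : s.1 ≤ t
  · simp only [extendYZ, h, dite_true]; rfl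
  · have hs : s.1 = t + 1 := le_antisymm s.2 (by omega)
    simp only [extendYZ, h, dite_false, Y, Z]
    rw [hs]

/-- Given the history of `(Y, Z)`, large values of `X` are possible. -/
lemma HasTransition.measure_eq_zero_of_inter_tail (h : HasTransition P K)
    (hac : ∀ w, K w ≪ volume) (hpos : ∀ w, volume ≪ K w) (t : ℤ) (v : ℝ) {B : Set Path}
    (hB : MeasurableSet[infoWithoutX t] B)
    (h0 : (P : Measure Path) (B ∩ {w | v < X t w}) = 0) : (P : Measure Path) B = 0 := by
  obtain ⟨s, rfl⟩ : ∃ s, t = s + 1 := ⟨t - 1, by ring⟩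
  obtain ⟨S, hS, rfl⟩ := hB
  have hT : MeasurableSet (extendYZ s ⁻¹' S) := measurable_extendYZ s hS
  have hv : MeasurableSet
      {p : (Set.Iic s → ℝ × ℝ × ℝ) × (ℝ × ℝ × ℝ) | v < p.2.1} :=
    measurableSet_lt measurable_const (by fun_prop)
  have e1 := h.measure_next s hT
  have e2 := h.measure_next s (hT.inter hv)
  have s1 : {w : Path | (history s w, w (s + 1)) ∈ extendYZ s ⁻¹' S} =
      (fun (w : Path) (u : Set.Iic (s + 1)) => (Y u w, Z u w)) ⁻¹' S := by
    ext w
    simp only [Set.mem_ofPred_eq, Set.mem_preimage, extendYZ_history]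
  have s2 : {w : Path | (history s w, w (s + 1)) ∈ extendYZ s ⁻¹' S ∩
      {p : (Set.Iic s → ℝ × ℝ × ℝ) × (ℝ × ℝ × ℝ) | v < p.2.1}} =
      (fun (w : Path) (u : Set.Iic (s + 1)) => (Y u w, Z u w)) ⁻¹' S ∩
        {w | v < X (s + 1) w} := by
    rw [← s1]; rfl
  rw [s1] at e1
  rw [s2, h0, eq_comm, lintegral_eq_zero_iff (HasTransition.measurable_next s (hT.inter hv))] at e2
  rw [e1, lintegral_eq_zero_iff (HasTransition.measurable_next s hT)]
  filter_upwards [e2] with w hw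
  refine hac _ ?_
  have h1 := hpos _ hw
  -- The event does not constrain the new `X`, so its section is `ℝ × U`. If `(v, ∞) × U` is null
  -- then `U` is null, and so is the whole section.
  set U : Set (ℝ × ℝ) := {q | extendYZ s (history s w, (0, q)) ∈ S} with hU
  have hmem (y : ℝ × ℝ × ℝ) : extendYZ s (history s w, y) = extendYZ s (history s w, (0, y.2)) := by
    rfl
  have hp1 : Prod.mk (history s w) ⁻¹' (extendYZ s ⁻¹' S) = Set.univ ×ˢ U := by
    ext y
    simp [hU, hmem y]
  have hp2 : Prod.mk (history s w) ⁻¹' (extendYZ s ⁻¹' S ∩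
      {p : (Set.Iic s → ℝ × ℝ × ℝ) × (ℝ × ℝ × ℝ) | v < p.2.1}) = Set.Ioi v ×ˢ U := by
    ext y
    simp [hU, hmem y, and_comm]
  rw [hp2, Measure.volume_eq_prod, Measure.prod_prod, Real.volume_Ioi] at h1
  rw [hp1, Measure.volume_eq_prod, Measure.prod_prod]
  have : volume U = 0 := by simpa using h1
  simp [this]

end Properties

/-! ### Bounds for the distribution function. -/

namespace IsUnboundedDistributionFunction

variable {F : ℝ → ℝ} (hF : IsUnboundedDistributionFunction F)

include hF

lemma nonneg (x : ℝ) : 0 ≤ F x :=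
  le_of_tendsto hF.tendsto_atBot ((eventually_le_atBot x).mono fun _ h => hF.mono h)

lemma measurable : Measurable F := hF.mono.measurable

lemma norm_le_one (x : ℝ) : ‖F x‖ ≤ 1 := by
  rw [Real.norm_of_nonneg (hF.nonneg x)]; exact (hF.lt_one x).le

lemma integrable {α : Type*} [MeasurableSpace α] {ν : Measure α} [IsFiniteMeasure ν] {f : α → ℝ}
    (hf : Measurable f) : Integrable (fun a => F (f a)) ν :=
  Integrable.of_bound (hF.measurable.comp hf).aestronglyMeasurable 1
    (ae_of_all _ fun _ => hF.norm_le_one _)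

/-- `1 - F` is positive everywhere, so its integral is positive; this gives the strict inequality of
the null hypothesis. -/
lemma integral_lt_one {α : Type*} [MeasurableSpace α] {ν : Measure α} [IsProbabilityMeasure ν]
    {f : α → ℝ} (hf : Measurable f) : ∫ a, F (f a) ∂ν < 1 := by
  have h : 0 < ∫ a, (1 - F (f a)) ∂ν := by
    rw [integral_pos_iff_support_of_nonneg (fun a => sub_nonneg.2 (hF.lt_one _).le)
      ((integrable_const 1).sub (hF.integrable hf))]
    have : Function.support (fun a => 1 - F (f a)) = Set.univ :=
      Set.eq_univ_of_forall fun a => (sub_pos.2 (hF.lt_one _)).ne'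
    simp [this]
  rw [integral_sub (integrable_const 1) (hF.integrable hf)] at h
  simpa using h

end IsUnboundedDistributionFunction

/-! ### The tail coefficient when the kernel is constant for large `X`. -/

section Tail

variable {P : Law} {K : Kernel (ℝ × ℝ × ℝ) (ℝ × ℝ × ℝ)} [IsMarkovKernel K]

lemma measurable_X (t : ℤ) : Measurable (X t) := (measurable_pi_apply t).fst

lemma measurable_Y (t : ℤ) : Measurable (Y t) := (measurable_pi_apply t).snd.fst

lemma measurableSet_tail (t : ℤ) (v : ℝ) : MeasurableSet {w | v < X t w} :=
  measurableSet_lt measurable_const (measurable_X t)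

lemma HasTransition.setIntegral_eq_const (h : HasTransition P K) {F : ℝ → ℝ}
    (hF : IsUnboundedDistributionFunction F) {M : ℝ}
    {ν : Measure (ℝ × ℝ × ℝ)} [IsProbabilityMeasure ν] (hK : ∀ w : ℝ × ℝ × ℝ, M < w.1 → K w = ν)
    (t : ℤ) {A : Set (Set.Iic t → ℝ × ℝ × ℝ)} (hA : MeasurableSet A)
    (hAM : ∀ a ∈ A, M < (present t a).1) :
    ∫ w in history t ⁻¹' A, F (Y (t + 1) w) ∂(P : Measure Path) =
      ∫ _ in history t ⁻¹' A, (∫ y, F y.2.1 ∂ν) ∂(P : Measure Path) := by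
  have hB : MeasurableSet (history t ⁻¹' A) := measurable_history t hA
  have hφ : Measurable fun y : ℝ × ℝ × ℝ => ENNReal.ofReal (F y.2.1) :=
    ENNReal.measurable_ofReal.comp (hF.measurable.comp (by fun_prop))
  have hf : Measurable fun p : (Set.Iic t → ℝ × ℝ × ℝ) × (ℝ × ℝ × ℝ) =>
      A.indicator (1 : (Set.Iic t → ℝ × ℝ × ℝ) → ℝ≥0∞) p.1 * ENNReal.ofReal (F p.2.2.1) :=
    ((measurable_one.indicator hA).comp measurable_fst).mul (hφ.comp measurable_snd)
  have key : ∫⁻ w in history t ⁻¹' A, ENNReal.ofReal (F (Y (t + 1) w)) ∂(P : Measure Path) =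
      ∫⁻ _ in history t ⁻¹' A, (∫⁻ y, ENNReal.ofReal (F y.2.1) ∂ν) ∂(P : Measure Path) := by
    rw [← lintegral_indicator hB, ← lintegral_indicator hB]
    have e := h.lintegral t hf
    refine Eq.trans ?_ (e.trans ?_)
    · refine lintegral_congr fun w => ?_
      by_cases hw : history t w ∈ A
      · rw [Set.indicator_of_mem (show w ∈ history t ⁻¹' A from hw),
          Set.indicator_of_mem hw, Pi.one_apply, one_mul]
        rfl
      · rw [Set.indicator_of_notMem (show w ∉ history t ⁻¹' A from hw),
          Set.indicator_of_notMem hw, zero_mul]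
    · refine lintegral_congr fun w => ?_
      by_cases hw : history t w ∈ A
      · rw [Set.indicator_of_mem (show w ∈ history t ⁻¹' A from hw)]
        simp only [Set.indicator_of_mem hw, Pi.one_apply, one_mul]
        rw [hK (w t) (hAM _ hw)]
      · rw [Set.indicator_of_notMem (show w ∉ history t ⁻¹' A from hw)]
        simp [Set.indicator_of_notMem hw]
  have hYm : Measurable fun w => F (Y (t + 1) w) := hF.measurable.comp (measurable_Y _)
  rw [integral_eq_lintegral_of_nonneg_ae (ae_of_all _ fun w => hF.nonneg _)
    hYm.aestronglyMeasurable, key, setLIntegral_const, setIntegral_const,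
    integral_eq_lintegral_of_nonneg_ae (ae_of_all _ fun w => hF.nonneg _)
    (hF.measurable.comp (by fun_prop)).aestronglyMeasurable, ENNReal.toReal_mul, mul_comm]
  rfl

lemma history_inter_tail {t : ℤ} {B : Set Path} (hB : MeasurableSet[infoWithoutX t] B) (v : ℝ) :
    ∃ A : Set (Set.Iic t → ℝ × ℝ × ℝ), MeasurableSet A ∧ (∀ a ∈ A, v < (present t a).1) ∧
      history t ⁻¹' A = B ∩ {w | v < X t w} := by
  obtain ⟨S, hS, rfl⟩ := hB
  have h1 : Measurable fun (a : Set.Iic t → ℝ × ℝ × ℝ) (s : Set.Iic t) => (a s).2 :=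
    measurable_pi_lambda _ fun s => (measurable_pi_apply s).snd
  refine ⟨(fun a s => (a s).2) ⁻¹' S ∩ {a | v < (present t a).1},
    (h1 hS).inter (measurableSet_lt measurable_const (by fun_prop)), fun a ha => ha.2, rfl⟩

/-- Beyond the threshold `M`, the conditional expectation of `F Y_{t+1}` does not depend on the
conditioning level. -/
lemma HasTransition.ae_setIntegral_condLaw (h : HasTransition P K) {F : ℝ → ℝ}
    (hF : IsUnboundedDistributionFunction F) {M : ℝ}
    {ν : Measure (ℝ × ℝ × ℝ)} [IsProbabilityMeasure ν] (hK : ∀ w : ℝ × ℝ × ℝ, M < w.1 → K w = ν)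
    (t : ℤ) {v : ℝ} (hv : M ≤ v) :
    ∀ᵐ w ∂(P : Measure Path), ∫ w' in {w' | v < X t w'}, F (Y (t + 1) w') ∂(condLaw P t w) =
      ∫ _ in {w' | v < X t w'}, (∫ y, F y.2.1 ∂ν) ∂(condLaw P t w) := by
  have hm := infoWithoutX_le t
  have hT := measurableSet_tail t v
  set f : Path → ℝ := {w' | v < X t w'}.indicator fun w' => F (Y (t + 1) w')
  set g : Path → ℝ := {w' | v < X t w'}.indicator fun _ => ∫ y, F y.2.1 ∂ν
  have hf : Integrable f (P : Measure Path) := (hF.integrable (measurable_Y _)).indicator hT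
  have hg : Integrable g (P : Measure Path) := (integrable_const _).indicator hT
  have hfg : (P : Measure Path)[f | infoWithoutX t] =ᵐ[(P : Measure Path)]
      (P : Measure Path)[g | infoWithoutX t] := by
    refine (ae_eq_condExp_of_forall_setIntegral_eq hm hf
      (fun s _ _ => integrable_condExp.integrableOn) (fun s hs _ => ?_)
      stronglyMeasurable_condExp.aestronglyMeasurable).symm
    rw [setIntegral_condExp hm hg hs, setIntegral_indicator hT, setIntegral_indicator hT]
    -- The intersection with the tail event belongs to the history, and `X_t > M` on it, so the next
    -- state has law `ν` there.
    obtain ⟨A, hA, hAv, hAB⟩ := history_inter_tail hs v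
    rw [← hAB]
    exact (h.setIntegral_eq_const hF hK t hA fun a ha => hv.trans_lt (hAv a ha)).symm
  filter_upwards [condExp_ae_eq_integral_condExpKernel hm hf,
    condExp_ae_eq_integral_condExpKernel hm hg, hfg] with w h1 h2 h3
  rw [h1, h2, integral_indicator hT, integral_indicator hT] at h3
  exact h3

lemma tendsto_setIntegral_tail {κ : Measure Path} {f : Path → ℝ} (hf : Integrable f κ) (t : ℤ)
    {v : ℝ} {u : ℕ → ℝ} (hu : Antitone u) (hvu : ∀ n, v < u n) (hlim : Tendsto u atTop (𝓝 v)) :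
    Tendsto (fun n => ∫ w in {w | u n < X t w}, f w ∂κ) atTop
      (𝓝 (∫ w in {w | v < X t w}, f w ∂κ)) := by
  have hU : {w | v < X t w} = ⋃ n, {w | u n < X t w} := by
    ext w
    simp only [Set.mem_iUnion]
    refine ⟨fun hw => ?_, fun ⟨n, hn⟩ => (hvu n).trans hn⟩
    exact ((hlim.eventually (gt_mem_nhds hw)).exists)
  rw [hU]
  exact tendsto_setIntegral_of_monotone (fun n => measurableSet_tail t _)
    (fun i j hij w hw => (hu hij).trans_lt hw) hf.integrableOn

/-- The exceptional null set must not depend on `v`: the identity is taken at all rational levels at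
once, then passed to real levels from above by `tendsto_setIntegral_tail`. -/
lemma HasTransition.ae_tailCondExp_eq (h : HasTransition P K) {F : ℝ → ℝ}
    (hF : IsUnboundedDistributionFunction F) {M : ℝ}
    {ν : Measure (ℝ × ℝ × ℝ)} [IsProbabilityMeasure ν] (hK : ∀ w : ℝ × ℝ × ℝ, M < w.1 → K w = ν)
    (t : ℤ) : ∀ᵐ w ∂(P : Measure Path), ∀ v, M ≤ v → condLaw P t w {w' | v < X t w'} ≠ 0 →
      tailCondExp P F t v w = ∫ y, F y.2.1 ∂ν := by
  have hall : ∀ᵐ w ∂(P : Measure Path), ∀ q : ℚ, M ≤ q →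
      ∫ w' in {w' | q < X t w'}, F (Y (t + 1) w') ∂(condLaw P t w) =
      ∫ _ in {w' | q < X t w'}, (∫ y, F y.2.1 ∂ν) ∂(condLaw P t w) :=
    ae_all_iff.2 fun q => eventually_imp_distrib_left.2 fun hq =>
      h.ae_setIntegral_condLaw hF hK t hq
  filter_upwards [hall] with w hw v hv hne
  have : IsProbabilityMeasure (condLaw P t w) := by unfold condLaw; infer_instance
  obtain ⟨u, hu, hvu, hlim⟩ := Real.exists_seq_rat_strictAnti_tendsto v
  have hanti : Antitone fun n => (u n : ℝ) := fun i j hij => Rat.cast_le.2 (hu.antitone hij)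
  have e1 := tendsto_setIntegral_tail (hF.integrable (ν := condLaw P t w) (measurable_Y (t + 1))) t
    hanti hvu hlim
  have e2 := tendsto_setIntegral_tail (integrable_const (μ := condLaw P t w)
    (∫ y, F y.2.1 ∂ν)) t hanti hvu hlim
  simp only [fun n => hw (u n) (hv.trans (hvu n).le)] at e1
  have e := tendsto_nhds_unique e1 e2
  rw [tailCondExp, ProbabilityTheory.cond, integral_smul_measure, e, setIntegral_const,
    smul_smul, smul_eq_mul, Measure.real, ← ENNReal.toReal_mul,
    ENNReal.inv_mul_cancel hne (measure_ne_top _ _), ENNReal.toReal_one, one_mul]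

/-- The event that the conditional tail probability vanishes lies in `infoWithoutX t` and meets the
tail event in a null set, hence is itself null. Integer levels suffice by monotonicity. -/
lemma HasTransition.ae_condLaw_tail_ne_zero (h : HasTransition P K)
    (hac : ∀ w, K w ≪ volume) (hpos : ∀ w, volume ≪ K w) (t : ℤ) :
    ∀ᵐ w ∂(P : Measure Path), ∀ v, condLaw P t w {w' | v < X t w'} ≠ 0 := by
  have hn (n : ℕ) : ∀ᵐ w ∂(P : Measure Path), condLaw P t w {w' | (n : ℝ) < X t w'} ≠ 0 := by
    have hm := infoWithoutX_le t
    have hT := measurableSet_tail t n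
    set B : Set Path := {w | condLaw P t w {w' | (n : ℝ) < X t w'} = 0} with hBdef
    have hB : MeasurableSet[infoWithoutX t] B := measurable_condExpKernel hT (measurableSet_singleton 0)
    have h1 := setIntegral_condExp (μ := (P : Measure Path)) hm
      ((integrable_const (1 : ℝ)).indicator hT) hB
    have h2 := condExpKernel_ae_eq_condExp (μ := (P : Measure Path)) hm hT
    have h3 : ∫ w in B, ((P : Measure Path)[{w' | (n : ℝ) < X t w'}.indicator fun _ => (1 : ℝ) |
        infoWithoutX t]) w ∂(P : Measure Path) = 0 := by
      refine integral_eq_zero_of_ae ?_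
      filter_upwards [ae_restrict_of_ae h2, ae_restrict_mem (hm _ hB)] with w hw hwB
      rw [← hw, measureReal_def, show condExpKernel (P : Measure Path) (infoWithoutX t) w
        {w' | (n : ℝ) < X t w'} = 0 from hwB]
      rfl
    rw [h3, setIntegral_indicator hT, setIntegral_const, smul_eq_mul, mul_one, eq_comm,
      measureReal_eq_zero_iff] at h1
    have := h.measure_eq_zero_of_inter_tail hac hpos t n hB h1
    rw [ae_iff]
    simpa [hBdef] using this
  filter_upwards [ae_all_iff.2 hn] with w hw v h0
  obtain ⟨n, hvn⟩ := exists_nat_ge v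
  exact hw n (measure_mono_null (fun w' hw' => hvn.trans_lt hw') h0)

/-- A stationary, structurally generated chain whose transition kernel is equivalent to Lebesgue
measure and constant where the first coordinate is large satisfies the null hypothesis. -/
lemma HasTransition.mem_nullClass (h : HasTransition P K) {F : ℝ → ℝ}
    (hF : IsUnboundedDistributionFunction F) (hs : IsStationary P)
    (hg : IsStructurallyGenerated P) (hac : ∀ w, K w ≪ volume) (hpos : ∀ w, volume ≪ K w) {M : ℝ}
    {ν : Measure (ℝ × ℝ × ℝ)} [IsProbabilityMeasure ν]
    (hK : ∀ w : ℝ × ℝ × ℝ, M < w.1 → K w = ν) : P ∈ nullClass F := by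
  refine ⟨⟨hs, hg, h.isMarkov, h.isContinuousLaw hac, h.isSupportedNearInfinity hpos⟩, fun t => ?_⟩
  filter_upwards [h.ae_condLaw_tail_ne_zero hac hpos t, h.ae_tailCondExp_eq hF hK t] with w h1 h2
  refine ⟨∫ y, F y.2.1 ∂ν, ⟨h1, ?_⟩, hF.integral_lt_one (by fun_prop)⟩
  refine tendsto_const_nhds.congr' ?_
  filter_upwards [eventually_ge_atTop M] with v hv
  exact (h2 v hv (h1 v)).symm

end Tail

/-! ### The refreshed kernel and its driving noise. -/

section Refresh

variable (K : Kernel (ℝ × ℝ × ℝ) (ℝ × ℝ × ℝ)) (ρ : Measure (ℝ × ℝ × ℝ)) (ε : ℝ≥0∞)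

/-- The kernel that with probability `ε` refreshes the state by a draw from `ρ`, and otherwise moves
according to `K`. -/
noncomputable def refreshKernel : Kernel (ℝ × ℝ × ℝ) (ℝ × ℝ × ℝ) where
  toFun w := (1 - ε) • K w + ε • ρ
  measurable' := by
    refine Measure.measurable_of_measurable_coe _ fun s hs => ?_
    simp only [Measure.add_apply, Measure.smul_apply, smul_eq_mul]
    exact ((K.measurable_coe hs).const_mul _).add_const _

lemma refreshKernel_apply (w : ℝ × ℝ × ℝ) : refreshKernel K ρ ε w = (1 - ε) • K w + ε • ρ := rfl

variable {K ρ ε}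

lemma lintegral_refreshKernel (f : ℝ × ℝ × ℝ → ℝ≥0∞) (w : ℝ × ℝ × ℝ) :
    ∫⁻ y, f y ∂(refreshKernel K ρ ε w) = (1 - ε) * ∫⁻ y, f y ∂(K w) + ε * ∫⁻ y, f y ∂ρ := by
  rw [refreshKernel_apply, lintegral_add_measure, lintegral_smul_measure, lintegral_smul_measure,
    smul_eq_mul, smul_eq_mul]

lemma isMarkovKernel_refreshKernel [IsMarkovKernel K] [IsProbabilityMeasure ρ] (hε : ε ≤ 1) :
    IsMarkovKernel (refreshKernel K ρ ε) :=
  ⟨fun w => ⟨by simp [refreshKernel_apply, tsub_add_cancel_of_le hε]⟩⟩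

/-- The noise that drives `refreshKernel K ρ ε`: a coin for the refresh, a uniform variable for the
moves according to `K`, and a draw from `ρ`. -/
noncomputable def refreshNoise (ρ : Measure (ℝ × ℝ × ℝ)) (ε : ℝ≥0∞) :
    Measure (Bool × unitInterval × (ℝ × ℝ × ℝ)) :=
  ((1 - ε) • Measure.dirac false + ε • Measure.dirac true).prod (volume.prod ρ)

lemma refreshNoise_apply [IsProbabilityMeasure ρ]
    {s : Set (Bool × unitInterval × (ℝ × ℝ × ℝ))} (hs : MeasurableSet s) :
    refreshNoise ρ ε s = (1 - ε) * volume.prod ρ (Prod.mk false ⁻¹' s) +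
      ε * volume.prod ρ (Prod.mk true ⁻¹' s) := by
  rw [refreshNoise, Measure.prod_apply hs, lintegral_add_measure, lintegral_smul_measure,
    lintegral_smul_measure, lintegral_dirac, lintegral_dirac]
  rfl

lemma isProbabilityMeasure_refreshNoise [IsProbabilityMeasure ρ] (hε : ε ≤ 1) :
    IsProbabilityMeasure (refreshNoise ρ ε) :=
  ⟨by simp [refreshNoise_apply MeasurableSet.univ, tsub_add_cancel_of_le hε]⟩

/-- There is a stationary, structurally generated law with transition kernel
`refreshKernel K ρ ε`. -/
lemma exists_law_hasTransition_refreshKernel [IsMarkovKernel K] [IsProbabilityMeasure ρ]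
    (hε0 : ε ≠ 0) (hε : ε ≤ 1) :
    ∃ P : Law, IsStationary P ∧ IsStructurallyGenerated P ∧
      HasTransition P (refreshKernel K ρ ε) := by
  have := isMarkovKernel_refreshKernel (K := K) (ρ := ρ) hε
  have := isProbabilityMeasure_refreshNoise (ρ := ρ) hε
  -- A Markov kernel is a measurable function of the state and a uniform variable; the coin decides
  -- between this function and the draw from `ρ`.
  obtain ⟨g, hg, hgK⟩ := K.exists_measurable_map_eq_unitInterval
  let G : Bool × unitInterval × (ℝ × ℝ × ℝ) → ℝ × ℝ × ℝ → ℝ × ℝ × ℝ :=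
    fun n w => if n.1 = true then n.2.2 else g w n.2.1
  let R : Set (Bool × unitInterval × (ℝ × ℝ × ℝ)) := {n | n.1 = true}
  have hR : MeasurableSet R := measurable_fst (measurableSet_singleton true)
  have hGm : Measurable fun p : (Bool × unitInterval × (ℝ × ℝ × ℝ)) × (ℝ × ℝ × ℝ) =>
      G p.1 p.2 := by
    refine Measurable.ite (measurable_fst.fst (measurableSet_singleton true)) (by fun_prop) ?_
    exact hg.comp (measurable_snd.prodMk (by fun_prop))
  have hG : ∀ e ∈ R, ∀ w w', G e w = G e w' := by
    intro e he w w'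
    have he' : e.1 = true := he
    simp [G, he']
  have hνR : refreshNoise ρ ε R ≠ 0 := by
    rw [refreshNoise_apply hR]
    simp [R, hε0]
  have hK (w) : refreshKernel K ρ ε w = (refreshNoise ρ ε).map fun n => G n w := by
    have hGw : Measurable fun n => G n w := hGm.comp measurable_prodMk_right
    have hgw : Measurable (g w) := hg.comp measurable_prodMk_left
    ext s hs
    rw [Measure.map_apply hGw hs, refreshNoise_apply (hGw hs), refreshKernel_apply, ← hgK w]
    have h1 : Prod.mk false ⁻¹' ((fun n => G n w) ⁻¹' s) = (g w ⁻¹' s) ×ˢ Set.univ := by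
      ext p; simp [G]
    have h2 : Prod.mk true ⁻¹' ((fun n => G n w) ⁻¹' s) = Set.univ ×ˢ s := by
      ext p; simp [G]
    simp [h1, h2, Measure.prod_prod, Measure.map_apply hgw hs]
  exact ⟨solutionLaw hGm hR (refreshNoise ρ ε), isStationary_solutionLaw hGm hR,
    isStructurallyGenerated_solutionLaw hGm hR hG hνR,
    hasTransition_solutionLaw hGm hR hG hνR hK⟩

end Refresh

/-! ### Comparison of the refreshed chain with the original one. -/

section Approximation

variable {P Q : Law} {K K₁ : Kernel (ℝ × ℝ × ℝ) (ℝ × ℝ × ℝ)} [IsMarkovKernel K]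
  [IsMarkovKernel K₁] {ρ : Measure (ℝ × ℝ × ℝ)} [IsProbabilityMeasure ρ] {ε : ℝ≥0∞}
  {G : Set (ℝ × ℝ × ℝ)}

lemma IsStationary.lintegral_eq (hQ : IsStationary Q) {f : ℝ × ℝ × ℝ → ℝ≥0∞} (hf : Measurable f)
    (t : ℤ) : ∫⁻ w, f (w t) ∂(Q : Measure Path) = ∫⁻ w, f (w 0) ∂(Q : Measure Path) := by
  have h := hQ.map_eq (φ := fun w => w 0) (by fun_prop) t
  simp only [zero_add] at h
  rw [← lintegral_map hf (by fun_prop), h, lintegral_map hf (by fun_prop)]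

lemma HasTransition.lintegral_next (h : HasTransition P K) {f : ℝ × ℝ × ℝ → ℝ≥0∞}
    (hf : Measurable f) (t : ℤ) : ∫⁻ w, f (w (t + 1)) ∂(P : Measure Path) =
      ∫⁻ w, ∫⁻ y, f y ∂(K (w t)) ∂(P : Measure Path) :=
  h.lintegral t (f := fun p => f p.2) (by fun_prop)

lemma IsStationary.lintegral_kernel (hs : IsStationary P) (h : HasTransition P K)
    {f : ℝ × ℝ × ℝ → ℝ≥0∞} (hf : Measurable f) :
    ∫⁻ w, f (w 0) ∂(P : Measure Path) = ∫⁻ w, ∫⁻ y, f y ∂(K (w 0)) ∂(P : Measure Path) := by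
  rw [← hs.lintegral_eq hf (0 + 1), h.lintegral_next hf]

/-- For integrands bounded by `1`, ignoring what happens off `G` costs at most the stationary mass
of the complement of `G`. -/
lemma IsStationary.lintegral_le_of_kernel_le (hs : IsStationary Q) (hG : MeasurableSet G)
    (hGQ : (Q : Measure Path) {w | w 0 ∉ G} ≤ ε ^ 2) (t : ℤ) {g h : Path → ℝ≥0∞}
    (hg : ∀ w, g w ≤ 1) (hgh : ∀ w : Path, w t ∈ G → g w ≤ h w) :
    ∫⁻ w, g w ∂(Q : Measure Path) ≤ ∫⁻ w, h w ∂(Q : Measure Path) + ε ^ 2 := by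
  have hi : Measurable (Gᶜ.indicator (1 : ℝ × ℝ × ℝ → ℝ≥0∞)) := measurable_one.indicator hG.compl
  have hm0 : Measurable fun w : Path => w 0 := measurable_pi_apply 0
  have hit : Measurable fun w : Path => Gᶜ.indicator (1 : ℝ × ℝ × ℝ → ℝ≥0∞) (w t) :=
    hi.comp (measurable_pi_apply t)
  have h1 : ∫⁻ w, Gᶜ.indicator (1 : ℝ × ℝ × ℝ → ℝ≥0∞) (w t) ∂(Q : Measure Path) ≤ ε ^ 2 := by
    rw [hs.lintegral_eq hi]
    refine le_trans (le_of_eq ?_) hGQ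
    rw [← lintegral_indicator_one (show MeasurableSet {w : Path | w 0 ∉ G} from
      hm0 hG.compl)]
    rfl
  refine le_trans ?_ (add_le_add le_rfl h1)
  rw [← lintegral_add_right _ hit]
  refine lintegral_mono fun w => ?_
  by_cases hw : w t ∈ G
  · exact (hgh w hw).trans le_self_add
  · rw [Set.indicator_of_mem (show w t ∈ Gᶜ from hw)]
    exact (hg w).trans le_add_self

lemma lintegral_le_one_of_le_one {α : Type*} [MeasurableSpace α] {ν : Measure α}
    [IsProbabilityMeasure ν] {f : α → ℝ≥0∞} (hf : ∀ a, f a ≤ 1) : ∫⁻ a, f a ∂ν ≤ 1 :=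
  (lintegral_mono hf).trans (by simp)

/-- The stationary law of the refreshed chain is close to that of the original chain. -/
lemma lintegral_stationary_le (hQs : IsStationary Q) (hQ : HasTransition Q K)
    (hPs : IsStationary P) (hP : HasTransition P (refreshKernel K₁ ρ ε)) (hε0 : ε ≠ 0)
    (hε : ε ≤ 1) (hG : MeasurableSet G) (hGQ : (Q : Measure Path) {w | w 0 ∉ G} ≤ ε ^ 2)
    (hK : ∀ w ∈ G, K₁ w = K w) (hρ : (1 - ε) • (Q : Measure Path).map (fun w => w 0) ≤ ρ)
    {f : ℝ × ℝ × ℝ → ℝ≥0∞} (hf : Measurable f) (hf1 : ∀ w, f w ≤ 1) :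
    ∫⁻ w, f (w 0) ∂(Q : Measure Path) ≤ ∫⁻ w, f (w 0) ∂(P : Measure Path) + 2 * ε := by
  have := isMarkovKernel_refreshKernel (K := K₁) (ρ := ρ) hε
  have ha : (1 - ε) + ε = 1 := tsub_add_cancel_of_le hε
  -- One step of the invariance equations turns an error `d` into `(1 - ε) * d + 2 * ε ^ 2` at most.
  -- The fixed point is `2 * ε`, and the initial error `1` is damped by `1 - ε` each time. The claim
  -- ranges over all `f` because the induction applies it to `w ↦ ∫⁻ y, f y ∂(K₁ w)`.
  have key (k : ℕ) : ∀ f : ℝ × ℝ × ℝ → ℝ≥0∞, Measurable f → (∀ w, f w ≤ 1) →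
      ∫⁻ w, f (w 0) ∂(Q : Measure Path) ≤
        ∫⁻ w, f (w 0) ∂(P : Measure Path) + (2 * ε + (1 - ε) ^ k) := by
    induction k with
    | zero =>
      intro f _ hf1
      refine (lintegral_le_one_of_le_one fun w => hf1 _).trans ?_
      rw [pow_zero, ← add_assoc]
      exact le_add_self
    | succ k ih =>
      intro f hf hf1
      set a := 1 - ε
      set q := ∫⁻ w, f (w 0) ∂(Q : Measure Path) with hq
      set r := ∫⁻ y, f y ∂ρ
      set p₁ := ∫⁻ w, ∫⁻ y, f y ∂(K₁ (w 0)) ∂(P : Measure Path) with hp₁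
      have hKf : Measurable fun w => ∫⁻ y, f y ∂(K₁ w) := hf.lintegral_kernel
      have hKf0 : Measurable fun w : Path => ∫⁻ y, f y ∂(K₁ (w 0)) :=
        hKf.comp (measurable_pi_apply 0)
      have hp : ∫⁻ w, f (w 0) ∂(P : Measure Path) = a * p₁ + ε * r := by
        rw [hPs.lintegral_kernel hP hf]
        simp only [lintegral_refreshKernel]
        rw [lintegral_add_right _ measurable_const, lintegral_const_mul _ hKf0,
          lintegral_const, measure_univ, mul_one]
      have h1 : q ≤ p₁ + (2 * ε + a ^ k) + ε ^ 2 := by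
        rw [hq, hQs.lintegral_kernel hQ hf]
        refine (hQs.lintegral_le_of_kernel_le hG hGQ 0
          (h := fun w => ∫⁻ y, f y ∂(K₁ (w 0))) (fun w => lintegral_le_one_of_le_one hf1)
          fun w hw => by rw [hK _ hw]).trans ?_
        gcongr
        exact ih _ hKf fun w => lintegral_le_one_of_le_one hf1
      have h2 : a * q ≤ r := by
        have := lintegral_mono' hρ (le_refl f)
        rwa [lintegral_smul_measure, lintegral_map hf (by fun_prop), smul_eq_mul] at this
      have hq1 : q ≤ 1 := lintegral_le_one_of_le_one fun w => hf1 _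
      have h3 : q ≤ r + ε := by
        calc q = a * q + ε * q := by rw [← add_mul, ha, one_mul]
          _ ≤ r + ε * 1 := by gcongr
          _ = r + ε := by rw [mul_one]
      have ha1 : a ≤ 1 := tsub_le_self
      calc q = a * q + ε * q := by rw [← add_mul, ha, one_mul]
        _ ≤ a * (p₁ + (2 * ε + a ^ k) + ε ^ 2) + ε * (r + ε) := by gcongr
        _ = (a * p₁ + ε * r) + (a * (2 * ε) + a * ε ^ 2 + ε ^ 2 + a ^ (k + 1)) := by ring
        _ ≤ (a * p₁ + ε * r) + (a * (2 * ε) + 1 * ε ^ 2 + ε ^ 2 + a ^ (k + 1)) := by gcongr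
        _ = (a * p₁ + ε * r) + ((a + ε) * (2 * ε) + a ^ (k + 1)) := by ring
        _ = _ := by rw [ha, one_mul, hp]
  have hlim : Tendsto (fun k : ℕ => ∫⁻ w, f (w 0) ∂(P : Measure Path) + (2 * ε + (1 - ε) ^ k)) atTop
      (𝓝 (∫⁻ w, f (w 0) ∂(P : Measure Path) + (2 * ε + 0))) :=
    (ENNReal.tendsto_pow_atTop_nhds_zero_of_lt_one
      (ENNReal.sub_lt_self ENNReal.one_ne_top one_ne_zero hε0)).const_add _ |>.const_add _
  rw [add_zero] at hlim
  exact ge_of_tendsto' hlim fun k => key k f hf hf1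

lemma HasTransition.lintegral_window_succ (h : HasTransition P K) (m : ℕ)
    {f : (Fin (m + 2) → ℝ × ℝ × ℝ) → ℝ≥0∞} (hf : Measurable f) :
    ∫⁻ w, f (fun i => w (0 + 1 + (i : ℕ))) ∂(P : Measure Path) =
      ∫⁻ w, ∫⁻ y, f (Fin.snoc (fun i : Fin (m + 1) => w (0 + 1 + (i : ℕ))) y)
        ∂(K (w (0 + 1 + (Fin.last m : ℕ)))) ∂(P : Measure Path) := by
  have e := h.lintegral_comp (0 + (m + 1 : ℕ)) (measurable_windowOfHistory 0 (m + 1))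
    (f := fun p => f (Fin.snoc p.1 p.2)) (hf.comp (measurable_snoc (m + 1)))
  have hl : (0 : ℤ) + 1 + ((Fin.last m : Fin (m + 1)) : ℕ) = 0 + (m + 1 : ℕ) := by
    rw [Fin.val_last]; push_cast; ring
  rw [hl]
  refine Eq.trans (lintegral_congr fun w => ?_) e
  rw [window_succ 0 (m + 1) w]
  rfl

/-- Finite samples of the refreshed chain are close in law to those of the original chain. -/
lemma lintegral_window_le (hQs : IsStationary Q) (hQ : HasTransition Q K)
    (hPs : IsStationary P) (hP : HasTransition P (refreshKernel K₁ ρ ε)) (hε0 : ε ≠ 0)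
    (hε : ε ≤ 1) (hG : MeasurableSet G) (hGQ : (Q : Measure Path) {w | w 0 ∉ G} ≤ ε ^ 2)
    (hK : ∀ w ∈ G, K₁ w = K w) (hρ : (1 - ε) • (Q : Measure Path).map (fun w => w 0) ≤ ρ)
    (m : ℕ) {f : (Fin (m + 1) → ℝ × ℝ × ℝ) → ℝ≥0∞} (hf : Measurable f) (hf1 : ∀ v, f v ≤ 1) :
    ∫⁻ w, f (fun i => w (0 + 1 + (i : ℕ))) ∂(Q : Measure Path) ≤
      ∫⁻ w, f (fun i => w (0 + 1 + (i : ℕ))) ∂(P : Measure Path) + (2 * ε + m * (ε + ε ^ 2)) := by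
  have := isMarkovKernel_refreshKernel (K := K₁) (ρ := ρ) hε
  have ha : (1 - ε) + ε = 1 := tsub_add_cancel_of_le hε
  induction m with
  | zero =>
    have hf' : Measurable fun x : ℝ × ℝ × ℝ => f fun _ => x := hf.comp (by fun_prop)
    have h := lintegral_stationary_le hQs hQ hPs hP hε0 hε hG hGQ hK hρ hf' fun x => hf1 _
    rw [← hQs.lintegral_eq hf' 1, ← hPs.lintegral_eq hf' 1] at h
    simpa using h
  | succ m ih =>
    rw [hQ.lintegral_window_succ m hf, hP.lintegral_window_succ m hf]
    set g : (Fin (m + 1) → ℝ × ℝ × ℝ) → ℝ≥0∞ :=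
      fun v => ∫⁻ y, f (Fin.snoc v y) ∂(K₁ (v (Fin.last m))) with hgdef
    have hsn : Measurable fun p : (Fin (m + 1) → ℝ × ℝ × ℝ) × (ℝ × ℝ × ℝ) => f (Fin.snoc p.1 p.2) :=
      hf.comp (measurable_snoc (m + 1))
    have hg : Measurable g := hsn.lintegral_kernel_prod_right'
      (κ := K₁.comap (fun v : Fin (m + 1) → ℝ × ℝ × ℝ => v (Fin.last m)) (measurable_pi_apply _))
    have hg1 (v) : g v ≤ 1 := lintegral_le_one_of_le_one fun y => hf1 _
    have hwin : Measurable fun (w : Path) (i : Fin (m + 1)) => w (0 + 1 + (i : ℕ)) := by fun_prop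
    have h1 : ∫⁻ w, ∫⁻ y, f (Fin.snoc (fun i : Fin (m + 1) => w (0 + 1 + (i : ℕ))) y)
        ∂(K (w (0 + 1 + (Fin.last m : ℕ)))) ∂(Q : Measure Path) ≤
        ∫⁻ w, g (fun i => w (0 + 1 + (i : ℕ))) ∂(Q : Measure Path) + ε ^ 2 :=
      hQs.lintegral_le_of_kernel_le hG hGQ (0 + 1 + (Fin.last m : ℕ))
        (fun w => lintegral_le_one_of_le_one fun y => hf1 _)
        fun w hw => by simp only [hgdef]; rw [hK _ hw]
    have h2 := ih hg hg1
    set p := ∫⁻ w, g (fun i => w (0 + 1 + (i : ℕ))) ∂(P : Measure Path)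
    have hp1 : p ≤ 1 := lintegral_le_one_of_le_one fun w => hg1 fun i => w (0 + 1 + (i : ℕ))
    -- The refresh part of the kernel is dropped; since `p ≤ 1` this loses at most ε.
    have h3 : (1 - ε) * p ≤ ∫⁻ w, ∫⁻ y,
        f (Fin.snoc (fun i : Fin (m + 1) => w (0 + 1 + (i : ℕ))) y)
        ∂(refreshKernel K₁ ρ ε (w (0 + 1 + (Fin.last m : ℕ)))) ∂(P : Measure Path) := by
      have hgw : Measurable fun w : Path => g fun i => w (0 + 1 + (i : ℕ)) := hg.comp hwin
      rw [← lintegral_const_mul _ hgw]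
      refine lintegral_mono fun w => ?_
      rw [lintegral_refreshKernel]
      exact le_self_add
    calc _ ≤ p + (2 * ε + m * (ε + ε ^ 2)) + ε ^ 2 := h1.trans (by gcongr)
      _ = ((1 - ε) * p + ε * p) + (2 * ε + m * (ε + ε ^ 2)) + ε ^ 2 := by
        rw [← add_mul, ha, one_mul]
      _ ≤ ((1 - ε) * p + ε * 1) + (2 * ε + m * (ε + ε ^ 2)) + ε ^ 2 := by gcongr
      _ = (1 - ε) * p + (2 * ε + (m + 1 : ℕ) * (ε + ε ^ 2)) := by push_cast; ring
      _ ≤ _ := by gcongr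

end Approximation

/-! ### Absolute continuity of the original kernel and construction of the null approximation. -/

lemma IsContinuousLaw.compProd_absolutelyContinuous {Q : Law} (hc : IsContinuousLaw Q) :
    (Q : Measure Path).map (fun w => w 0) ⊗ₘ transitionKernel Q ≪
      volume ⊗ₘ Kernel.const _ (volume : Measure (ℝ × ℝ × ℝ)).toFinite := by
  have hp := volume_preserving_piFinTwo fun _ : Fin 2 => ℝ × ℝ × ℝ
  -- The window of length `2` after time `-1` is `(W_0, W_1)`.
  have h := (hc (-1) 2).map hp.measurable
  rw [hp.map_eq, Measure.map_map hp.measurable (by fun_prop)] at h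
  have e : (Q : Measure Path).map (fun w => w 0) ⊗ₘ transitionKernel Q =
      (Q : Measure Path).map fun w => (w 0, w 1) :=
    compProd_map_condDistrib (mβ := inferInstance) (measurable_pi_apply 1).aemeasurable
  rw [e, Measure.compProd_const]
  exact h.trans (Measure.AbsolutelyContinuous.rfl.prod (absolutelyContinuous_toFinite _))

lemma IsContinuousLaw.map_zero_absolutelyContinuous {Q : Law} (hc : IsContinuousLaw Q) :
    (Q : Measure Path).map (fun w => w 0) ≪ volume :=
  Measure.absolutelyContinuous_of_compProd hc.compProd_absolutelyContinuous

lemma IsContinuousLaw.ae_transitionKernel_absolutelyContinuous {Q : Law} (hc : IsContinuousLaw Q) :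
    ∀ᵐ w ∂((Q : Measure Path).map fun w => w 0),
      transitionKernel Q w ≪ (volume : Measure (ℝ × ℝ × ℝ)).toFinite :=
  (Measure.absolutelyContinuous_compProd_of_compProd
    hc.compProd_absolutelyContinuous).kernel_of_compProd

/-- Every law of the model class can be approximated, as far as finite samples are concerned, by
laws that satisfy the null hypothesis. -/
lemma exists_mem_nullClass_lintegral_window_le {F : ℝ → ℝ}
    (hF : IsUnboundedDistributionFunction F) {Q : Law} (hQ : Q ∈ modelClass) {ε : ℝ≥0∞}
    (hε0 : ε ≠ 0) (hε : ε ≤ 1) :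
    ∃ P ∈ nullClass F, ∀ (m : ℕ) (f : (Fin (m + 1) → ℝ × ℝ × ℝ) → ℝ≥0∞), Measurable f →
      (∀ v, f v ≤ 1) → ∫⁻ w, f (fun i => w (0 + 1 + (i : ℕ))) ∂(Q : Measure Path) ≤
        ∫⁻ w, f (fun i => w (0 + 1 + (i : ℕ))) ∂(P : Measure Path) +
          (2 * ε + m * (ε + ε ^ 2)) := by
  classical
  obtain ⟨hQs, -, hQM, hQc, -⟩ := hQ
  have hQt := hasTransition_transitionKernel hQs hQM
  set π : Measure (ℝ × ℝ × ℝ) := (Q : Measure Path).map fun w => w 0 with hπ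
  have hm0 : Measurable fun w : Path => w 0 := measurable_pi_apply 0
  have hπp : IsProbabilityMeasure π := Measure.isProbabilityMeasure_map hm0.aemeasurable
  set τ : Measure (ℝ × ℝ × ℝ) := (volume : Measure (ℝ × ℝ × ℝ)).toFinite
  have ha : (1 - ε) + ε = 1 := tsub_add_cancel_of_le hε
  set ρ : Measure (ℝ × ℝ × ℝ) := (1 - ε) • π + ε • τ with hρ
  have hρp : IsProbabilityMeasure ρ := ⟨by simp [hρ, ha]⟩
  -- The mass `ε ^ 2`, rather than ε, is needed because about `1 / ε` steps elapse between
  -- refreshes.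
  obtain ⟨M, hM⟩ : ∃ M : ℝ, π {w | M < w.1} ≤ ε ^ 2 := by
    have hlim := tendsto_measure_iInter_atTop (μ := π) (s := fun n : ℕ => {w | (n : ℝ) < w.1})
      (fun n => (measurableSet_lt measurable_const measurable_fst).nullMeasurableSet)
      (fun i j hij w (hw : (j : ℝ) < w.1) => lt_of_le_of_lt (Nat.cast_le.2 hij) hw) ⟨0, measure_ne_top _ _⟩
    have hemp : ⋂ n : ℕ, {w : ℝ × ℝ × ℝ | (n : ℝ) < w.1} = ∅ := by
      refine Set.eq_empty_of_forall_notMem fun w hw => ?_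
      obtain ⟨n, hn⟩ := exists_nat_ge w.1
      exact absurd (Set.mem_iInter.1 hw n) (not_lt.2 hn)
    rw [hemp, measure_empty] at hlim
    obtain ⟨n, hn⟩ := (hlim.eventually (gt_mem_nhds (pos_iff_ne_zero.2 (pow_ne_zero 2 hε0)))).exists
    exact ⟨n, hn.le⟩
  -- The second condition discards a π-null set, so that the modified kernel is absolutely
  -- continuous at every state.
  set G : Set (ℝ × ℝ × ℝ) := {w | w.1 ≤ M} ∩ {w | transitionKernel Q w ≪ τ} with hGdef
  have hG : MeasurableSet G := (measurableSet_le measurable_fst measurable_const).inter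
    (Kernel.measurableSet_absolutelyContinuous (transitionKernel Q) (Kernel.const _ τ))
  have hGQ : (Q : Measure Path) {w | w 0 ∉ G} ≤ ε ^ 2 := by
    have h1 : π Gᶜ ≤ ε ^ 2 := by
      refine le_trans (measure_mono_ae ?_) hM
      filter_upwards [hQc.ae_transitionKernel_absolutelyContinuous] with w hw hwG
      by_contra h
      exact hwG ⟨not_lt.1 h, hw⟩
    rwa [hπ, Measure.map_apply hm0 hG.compl] at h1
  set K₁ : Kernel (ℝ × ℝ × ℝ) (ℝ × ℝ × ℝ) :=
    Kernel.piecewise hG (transitionKernel Q) (Kernel.const _ ρ) with hK₁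
  have hK₁G (w) (hw : w ∈ G) : K₁ w = transitionKernel Q w := by
    rw [hK₁, Kernel.piecewise_apply, if_pos hw]
  have hK₁G' (w) (hw : w ∉ G) : K₁ w = ρ := by
    rw [hK₁, Kernel.piecewise_apply, if_neg hw, Kernel.const_apply]
  obtain ⟨P, hPs, hPg, hPt⟩ :=
    exists_law_hasTransition_refreshKernel (K := K₁) (ρ := ρ) hε0 hε
  have := isMarkovKernel_refreshKernel (K := K₁) (ρ := ρ) hε
  have hτ : τ ≪ volume := toFinite_absolutelyContinuous _
  have hρac : ρ ≪ volume :=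
    (hQc.map_zero_absolutelyContinuous.smul_left _).add_left (hτ.smul_left _)
  refine ⟨P, hPt.mem_nullClass hF hPs hPg (fun w => ?_) (fun w => ?_) (M := M)
    (ν := refreshKernel K₁ ρ ε (M + 1, 0, 0)) (fun w hw => ?_), fun m f hf hf1 =>
    lintegral_window_le hQs hQt hPs hPt hε0 hε hG hGQ hK₁G
      (Measure.le_add_right le_rfl) m hf hf1⟩
  · refine (Measure.AbsolutelyContinuous.smul_left ?_ _).add_left (hρac.smul_left _)
    by_cases hw : w ∈ G
    · rw [hK₁G w hw]
      exact hw.2.trans hτ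
    · rwa [hK₁G' w hw]
  -- The kernel dominates `ε ^ 2 • τ`, and Lebesgue measure is absolutely continuous with respect to
  -- `τ`.
  · refine (absolutelyContinuous_toFinite _).trans (Measure.AbsolutelyContinuous.mk fun s _ hs => ?_)
    have h0 : (1 - ε = 0 ∨ K₁ w s = 0) ∧ (1 - ε = 0 ∨ π s = 0) ∧ τ s = 0 := by
      simpa [refreshKernel_apply, hρ, hε0] using hs
    exact h0.2.2
  -- Beyond `M` all states lie off `G`, so the kernel agrees with its value at the reference state
  -- `(M + 1, 0, 0)`.
  · rw [refreshKernel_apply, refreshKernel_apply, hK₁G' w fun h => not_lt.2 h.1 hw,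
      hK₁G' _ fun h => not_lt.2 h.1 (lt_add_one M)]

end TailTesting

/-! ### Untestability for a fixed sample size. -/

theorem mainTheorem9 (F : ℝ → ℝ) (hF : TailTesting.IsUnboundedDistributionFunction F)
    (n : ℕ) (ψ : (Fin n → ℝ × ℝ × ℝ) → Fin 2) (hψ : Measurable ψ) :
    (⨆ Q ∈ TailTesting.alternativeClass F, TailTesting.rejectionProb ψ Q) ≤
      (⨆ P ∈ TailTesting.nullClass F, TailTesting.rejectionProb ψ P) := by
  refine iSup₂_le fun Q hQ => ENNReal.le_of_forall_pos_le_add fun δ hδ _ => ?_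
  -- As `ε ^ 2 ≤ ε`, the approximation error is at most `2 * ε + n * (2 * ε) = ε * (2 * (n + 1)) ≤
  -- δ`.
  set ε : NNReal := min 1 (δ / (2 * (n + 1))) with hε
  have hε0 : (ε : ℝ≥0∞) ≠ 0 := by
    rw [ENNReal.coe_ne_zero]
    exact (lt_min one_pos (by positivity)).ne'
  have hε1 : (ε : ℝ≥0∞) ≤ 1 := by exact_mod_cast min_le_left _ _
  obtain ⟨P, hP, hPQ⟩ :=
    TailTesting.exists_mem_nullClass_lintegral_window_le hF hQ.1 hε0 hε1
  -- The comparison is for nonempty windows; one extra observation, ignored by the test, also covers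
  -- `n = 0`.
  let S : Set (Fin (n + 1) → ℝ × ℝ × ℝ) := {v | ψ (fun i => v i.castSucc) = 1}
  have hS : MeasurableSet S := (hψ.comp (by fun_prop)) (measurableSet_singleton 1)
  have hrej (L : TailTesting.Law) : ∫⁻ w, S.indicator 1 (fun i : Fin (n + 1) => w (0 + 1 + (i : ℕ)))
      ∂(L : Measure TailTesting.Path) = TailTesting.rejectionProb ψ L := by
    have hw : Measurable fun (w : TailTesting.Path) (i : Fin (n + 1)) => w (0 + 1 + (i : ℕ)) := by
      fun_prop
    rw [← lintegral_map (measurable_one.indicator hS) hw, lintegral_indicator_one hS,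
      Measure.map_apply hw hS]
    simp [TailTesting.rejectionProb, S]
  have h := hPQ n (S.indicator 1) (measurable_one.indicator hS)
    fun v => Set.indicator_le_self' (fun _ _ => zero_le) v
  rw [hrej, hrej] at h
  have hbound : 2 * (ε : ℝ≥0∞) + n * (ε + (ε : ℝ≥0∞) ^ 2) ≤ δ := by
    have h1 : ε ^ 2 ≤ ε := by
      rw [sq]; exact mul_le_of_le_one_left' (min_le_left _ _)
    have h2 : 2 * ε + n * (ε + ε ^ 2) ≤ δ := by
      calc 2 * ε + n * (ε + ε ^ 2) ≤ 2 * ε + n * (ε + ε) := by gcongr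
        _ = ε * (2 * (n + 1)) := by ring
        _ ≤ δ / (2 * (n + 1)) * (2 * (n + 1)) := by gcongr; exact min_le_right _ _
        _ = δ := div_mul_cancel₀ _ (by positivity)
    exact_mod_cast h2
  calc _ ≤ TailTesting.rejectionProb ψ P + δ := h.trans (by gcongr)
    _ ≤ _ := by
      gcongr
      exact le_iSup₂ (f := fun P _ => TailTesting.rejectionProb ψ P) P hP
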